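/- Setting. Let $G$ be a finite group, $p$ a prime, $R$ the ring of algebraic integers in $\mathbb C$, $K$ its field of fractions, $I$ a maximal ideal of $R$ containing $p$ and $F=R/I$. Brauer characters are those of $F$-representations of $G$, defined by lifting eigenvalues to $|G|_{p'}$-th roots of unity in $R$, and are extended by $0$ to the $p$-singular elements. Let $\mathrm{Irr}(G)$ be the set of irreducible $K$-characters and $\mathrm{IBr}(G)$ the set of irreducible Brauer characters. For $\chi\in\mathrm{Irr}(G)$ let $\hat\chi$ be $\chi$ on $p$-regular and $0$ on $p$-singular elements, and write $\hat\chi=\sum_{\varphi\in\mathrm{IBr}(G)}d_{\chi\varphi}\varphi$ with $d_{\chi\varphi}\in\mathbb Z_{\ge 0}$. The projective indecomposable characters (PIMs) are $\Phi_\varphi=\sum_{\chi\in\mathrm{Irr}(G)}d_{\chi\varphi}\chi$, for $\varphi\in\mathrm{IBr}(G)$; a (genuine) projective character is a linear combination of PIMs with coefficients in $\mathbb Z_{\ge0}$. Put $\langle\lambda,\mu\rangle=|G|^{-1}\sum_{g\in G}\lambda(g)\overline{\mu(g)}$. Let $\mathcal B$ be a union of $p$-blocks of $G$, i.e. of connected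 components of the graph on $\mathrm{Irr}(G)$ in which $\chi,\psi$ are linked if $d_{\chi\varphi}\ne0\ne d_{\psi\varphi}$ for some $\varphi$; an irreducible Brauer character $\varphi$ and its PIM $\Phi_\varphi$ lie in $\mathcal B$ if $d_{\chi\varphi}\neq 0$ for some $\chi\in\mathcal B$. Let $G_0$ (respectively $K_0$) be the group of $\mathbb Z$-linear combinations of the irreducible Brauer characters (respectively PIMs) in $\mathcal B$. Let $\mathbf{BS}=\{\varphi_1,\dots,\varphi_s\}$ be a $\mathbb Z$-basis of $G_0$ consisting of Brauer characters and $\mathbf{PS}=\{\Phi_1,\dots,\Phi_s\}$ a $\mathbb Z$-basis of $K_0$ consisting of projective characters. Let $\{\varphi_1^*,\dots,\varphi_s^*\}\subset K_0$ be the basis dual to $\mathbf{BS}$ and $\{\Phi_1^*,\dots,\Phi_s^*\}\subset G_0$ the basis dual to $\mathbf{PS}$ with respect to $\langle\ ,\ \rangle$. Let $\mathbf B$ be a set of Brauer characters and $\mathbf P$ a set of projective characters of $G$. Let $J\subseteq\{1,\dots,s\}$ be such that $\Phi_j$ is a PIM for every $j\in J$. For $1\le i,j\le s$ put $m_{ij}=\infty$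 if $i\notin J$; $m_{ij}=\delta_{ij}$ if $i,j\in J$; and, if $i\in J$, $j\notin J$, $$m_{ij}=\max\{n\in\mathbb Z_{\ge0}\mid \langle\varphi,\Phi_j-n\Phi_i\rangle\ge0\text{ for all }\varphi\in\mathbf B\cup\mathbf{BS}\}.$$ Call $\Phi_k$ multiplicity free if its coefficients with respect to $\varphi_1^*,\dots,\varphi_s^*$ all lie in $\{0,1\}$. Let $\Phi=\Phi_k\in\mathbf{PS}$ and suppose that (i) $\Phi$ is indecomposable and $k\in J$, respectively (ii) $\Phi$ is multiplicity free. For $\varphi=\sum_i n_i\Phi_i^*\in\mathbf{BS}$ with $\langle\varphi,\Phi\rangle>0$, a bit of $\varphi$ with respect to $\Phi$ is an element $\varphi'=\sum_i n_i'\Phi_i^*$ with $n'_i\in\mathbb Z$ such that (a) $0\le n_i'\le n_i$ for all $i$; (b) $n_k'=1$ and, in case (i), $n_i'=0$ for $i\in J\setminus\{k\}$ and $n_i'\le m_{ki}$ for $i\notin J$; respectively, in case (ii), $n_i'\le m_{ik}$ for $i\in J$; (c) $\langle\varphi',\Psi\rangle\ge0$ and $\langle\varphi-\varphi',\Psi\rangle\ge0$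 for all $\Psi\in\mathbf P$. Theorem. Let $\Sigma\in\mathbf P$. For every $\varphi\in\mathbf{BS}$ with $\langle\varphi,\Phi\rangle>0$ the minimum $$m(\Phi,\Sigma,\varphi)=\min\{\langle\varphi',\Sigma\rangle\mid\varphi'\text{ is a bit of }\varphi\text{ with respect to }\Phi\}$$ exists and is a non-negative integer, and there is at least one such $\varphi$. In case (i) let $$z=\max\{m(\Phi,\Sigma,\varphi)\mid\varphi\in\mathbf{BS},\ \langle\varphi,\Phi\rangle>0\},$$ and in case (ii) let $$z=\min\{m(\Phi,\Sigma,\varphi)\mid\varphi\in\mathbf{BS},\ \langle\varphi,\Phi\rangle>0\}.$$ Then, in either case, $\Sigma-z\Phi$ is a genuine projective character. -/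

import Mathlib

open scoped ComplexOrder

noncomputable section

namespace ModChar

/-! ### The `p`-modular system -/

/-- The field `K` of algebraic numbers, inside `ℂ`. -/
abbrev AlgNum : Type := algebraicClosure ℚ ℂ

/-- The ring `R` of algebraic integers; its field of fractions is `AlgNum`. -/
abbrev AlgInt : Type := integralClosure ℤ AlgNum

/-- The residue class field `F = R / I`. -/
abbrev ResField (I : Ideal AlgInt) : Type := AlgInt ⧸ I

instance instFieldResField (I : Ideal AlgInt) [I.IsMaximal] : Field (ResField I) :=
  Ideal.Quotient.field I

variable {G : Type*} [Group G] [Fintype G]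

/-! ### Class functions, ordinary characters, Brauer characters -/

/-- The usual inner product `⟨λ, μ⟩ = |G|⁻¹ ∑ λ(g) conj (μ(g))`. -/
def ip (l m : G → ℂ) : ℂ :=
  (Fintype.card G : ℂ)⁻¹ * ∑ g : G, l g * (starRingEnd ℂ) (m g)

/-- `χ ↦ χ̂`: the function which agrees with `χ` on the `p`-regular elements and is zero on the
`p`-singular ones. -/
def hat (p : ℕ) (χ : G → ℂ) : G → ℂ := fun g => if p ∣ orderOf g then 0 else χ g

/-- The ordinary character of a `K`-representation, as a function with values in `K ⊆ ℂ`. -/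
def ordinaryCharacter {n : ℕ} (X : Representation AlgNum G (Fin n → AlgNum)) : G → ℂ :=
  fun g => ((X.character g : AlgNum) : ℂ)

variable (G) in
/-- `Irr(G)`. -/
def Irr : Set (G → ℂ) :=
  {χ | ∃ (n : ℕ) (X : Representation AlgNum G (Fin n → AlgNum)),
    X.IsIrreducible ∧ χ = ordinaryCharacter X}

variable (G) in
/-- The inverse of the bijection `R → F` between the `|G|_{p'}`-th roots of unity. -/
def rootLift (p : ℕ) (I : Ideal AlgInt) (ζ : ResField I) : AlgInt :=
  Function.invFunOn (Ideal.Quotient.mk I)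
    {u : AlgInt | u ^ (ordCompl[p] (Fintype.card G)) = 1} ζ

/-- The Brauer character of an `F`-representation: on a `p`-regular element, the sum of the lifts
of the eigenvalues (with multiplicities); extended by zero to the `p`-singular elements. -/
def brauerCharacter (p : ℕ) (I : Ideal AlgInt) [I.IsMaximal] {n : ℕ}
    (X : Representation (ResField I) G (Fin n → ResField I)) : G → ℂ :=
  fun g => if p ∣ orderOf g then 0 else
    ((LinearMap.charpoly (X g)).roots.map
      (fun ζ => (((rootLift G p I ζ : AlgInt) : AlgNum) : ℂ))).sum

/-- `θ` is a (genuine) Brauer character: it is afforded by some `F`-representation. -/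
def IsBrauerCharacter (p : ℕ) (I : Ideal AlgInt) [I.IsMaximal] (θ : G → ℂ) : Prop :=
  ∃ (n : ℕ) (X : Representation (ResField I) G (Fin n → ResField I)), θ = brauerCharacter p I X

variable (G) in
/-- `IBr(G)`. -/
def IBr (p : ℕ) (I : Ideal AlgInt) [I.IsMaximal] : Set (G → ℂ) :=
  {φ | ∃ (n : ℕ) (X : Representation (ResField I) G (Fin n → ResField I)),
    X.IsIrreducible ∧ φ = brauerCharacter p I X}

/-! ### Decomposition numbers and projective characters -/

open scoped Classical in
/-- The row `(d_{χφ})_φ` of the decomposition matrix: the non-negative integers with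
`χ̂ = ∑_φ d_{χφ} φ`. They are unique because `IBr(G)` is linearly independent. -/
def decompRow (p : ℕ) (I : Ideal AlgInt) [I.IsMaximal] (χ : G → ℂ) : IBr G p I →₀ ℕ :=
  if h : ∃ d : IBr G p I →₀ ℕ, hat p χ = d.sum (fun φ k => k • (φ : G → ℂ)) then h.choose else 0

/-- The decomposition number `d_{χφ}`. -/
def decompNumber (p : ℕ) (I : Ideal AlgInt) [I.IsMaximal] (χ : G → ℂ) (φ : IBr G p I) : ℕ :=
  decompRow p I χ φ

/-- The projective indecomposable character `Φ_φ = ∑_χ d_{χφ} χ`. -/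
def pim (p : ℕ) (I : Ideal AlgInt) [I.IsMaximal] (φ : IBr G p I) : G → ℂ :=
  ∑ᶠ χ : Irr G, decompNumber p I (χ : G → ℂ) φ • (χ : G → ℂ)

/-- `Φ` is a projective indecomposable character (PIM). -/
def IsPIM (p : ℕ) (I : Ideal AlgInt) [I.IsMaximal] (Φ : G → ℂ) : Prop :=
  ∃ φ : IBr G p I, Φ = pim p I φ

/-- `Ψ` is a (genuine) projective character: a `ℤ`-linear combination of PIMs with non-negative
coefficients. -/
def IsProjectiveCharacter (p : ℕ) (I : Ideal AlgInt) [I.IsMaximal] (Ψ : G → ℂ) : Prop :=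
  Ψ ∈ AddSubmonoid.closure {Φ : G → ℂ | IsPIM p I Φ}

/-! ### Blocks -/

variable (G) in
/-- The Brauer graph: its vertices are the irreducible ordinary characters, two of them being
linked if they have a common irreducible Brauer constituent. -/
def brauerGraph (p : ℕ) (I : Ideal AlgInt) [I.IsMaximal] : SimpleGraph (Irr G) :=
  SimpleGraph.fromRel fun χ ψ =>
    ∃ φ : IBr G p I, decompNumber p I (χ : G → ℂ) φ ≠ 0 ∧ decompNumber p I (ψ : G → ℂ) φ ≠ 0

variable (G) in
/-- The blocks of `G`: the connected components of the Brauer graph. -/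
abbrev Block (p : ℕ) (I : Ideal AlgInt) [I.IsMaximal] : Type _ :=
  (brauerGraph G p I).ConnectedComponent

section Blocks

variable {p : ℕ} {I : Ideal AlgInt} [I.IsMaximal]

/-- The irreducible Brauer character `φ` belongs to the union `B` of blocks. -/
def InBlocks (B : Set (Block G p I)) (φ : IBr G p I) : Prop :=
  ∃ χ : Irr G, (brauerGraph G p I).connectedComponentMk χ ∈ B ∧
    decompNumber p I (χ : G → ℂ) φ ≠ 0

/-- `G₀(B̂)`: the `ℤ`-linear combinations of `IBr(B)`, i.e. the generalized Brauer characters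
in `B`. -/
def G0 (B : Set (Block G p I)) : Submodule ℤ (G → ℂ) :=
  Submodule.span ℤ {θ | ∃ φ : IBr G p I, InBlocks B φ ∧ θ = (φ : G → ℂ)}

/-- `K₀(B)`: the `ℤ`-linear combinations of `IPr(B)`, i.e. the generalized projective characters
in `B`. -/
def K0 (B : Set (Block G p I)) : Submodule ℤ (G → ℂ) :=
  Submodule.span ℤ {Φ | ∃ φ : IBr G p I, InBlocks B φ ∧ Φ = pim p I φ}

/-! ### Basic sets and atoms -/

/-- `BS` is a basic set of Brauer characters for `B`: a `ℤ`-basis of `G₀(B̂)` consisting of Brauer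
characters. -/
structure IsBasicBrauer (B : Set (Block G p I)) {s : ℕ} (BS : Fin s → G → ℂ) : Prop where
  linearIndependent : LinearIndependent ℤ BS
  span_eq : Submodule.span ℤ (Set.range BS) = G0 B
  genuine : ∀ i, IsBrauerCharacter p I (BS i)

/-- `PS` is a basic set of projective characters for `B`: a `ℤ`-basis of `K₀(B)` consisting of
projective characters. -/
structure IsBasicProjective (B : Set (Block G p I)) {s : ℕ} (PS : Fin s → G → ℂ) : Prop where
  linearIndependent : LinearIndependent ℤ PS
  span_eq : Submodule.span ℤ (Set.range PS) = K0 B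
  genuine : ∀ i, IsProjectiveCharacter p I (PS i)

open scoped Classical in
/-- The system in the lattice `X` dual to the system `b` with respect to the inner product. -/
def dualSystem (X : Submodule ℤ (G → ℂ)) {s : ℕ} (b : Fin s → G → ℂ) : Fin s → G → ℂ :=
  if h : ∃ a : Fin s → G → ℂ, (∀ i, a i ∈ X) ∧ ∀ i j, ip (b i) (a j) = if i = j then 1 else 0
  then h.choose else 0

/-- The projective atoms `PA = {φ₁*, …, φ_s*}`: the basis of `K₀(B)` dual to `BS`. -/
def projAtoms (B : Set (Block G p I)) {s : ℕ} (BS : Fin s → G → ℂ) : Fin s → G → ℂ :=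
  dualSystem (K0 B) BS

/-- The Brauer atoms `BA = {Φ₁*, …, Φ_s*}`: the basis of `G₀(B̂)` dual to `PS`. -/
def brauerAtoms (B : Set (Block G p I)) {s : ℕ} (PS : Fin s → G → ℂ) : Fin s → G → ℂ :=
  dualSystem (G0 B) PS

/-- `Φ` is multiplicity free: its coefficients with respect to the projective atoms dual to `BS`
are all `0` or `1`. -/
def MultiplicityFree (B : Set (Block G p I)) {s : ℕ} (BS : Fin s → G → ℂ) (Φ : G → ℂ) : Prop :=
  ∃ n : Fin s → ℕ, Φ = ∑ i, n i • projAtoms B BS i ∧ ∀ i, n i = 0 ∨ n i = 1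

end Blocks

/-! ### Bits -/

open scoped Classical in
/-- The maximal multiplicity `m_{ij}` of `Φ_i` in `Φ_j`, where `J` is the set of indices of the
known PIMs in `PS` and `T` is the set of test characters. -/
def maxMult {s : ℕ} (PS : Fin s → G → ℂ) (J : Set (Fin s)) (T : Set (G → ℂ)) (i j : Fin s) : ℕ∞ :=
  if i ∉ J then ⊤
  else if j ∈ J then (if i = j then 1 else 0)
  else ⨆ n ∈ {n : ℕ | ∀ φ ∈ T, 0 ≤ ip φ (PS j - n • PS i)}, (n : ℕ∞)

section Bits

variable {p : ℕ} {I : Ideal AlgInt} [I.IsMaximal]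

/-- `φ'` is a bit of `φ` with respect to the PIM `PS k`, where `J ∋ k` is the set of indices of the
known PIMs in `PS`; `P` and `T` are the sets of projective characters and of Brauer characters
used for testing. -/
def IsPimBit (B : Set (Block G p I)) {s : ℕ} (PS : Fin s → G → ℂ) (P T : Set (G → ℂ))
    (J : Set (Fin s)) (k : Fin s) (φ φ' : G → ℂ) : Prop :=
  ∃ n n' : Fin s → ℕ,
    φ = ∑ i, n i • brauerAtoms B PS i ∧
    φ' = ∑ i, n' i • brauerAtoms B PS i ∧
    (∀ i, n' i ≤ n i) ∧
    n' k = 1 ∧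
    (∀ i ∈ J, i ≠ k → n' i = 0) ∧
    (∀ i ∉ J, (n' i : ℕ∞) ≤ maxMult PS J T k i) ∧
    ∀ Ψ ∈ P, 0 ≤ ip φ' Ψ ∧ 0 ≤ ip (φ - φ') Ψ

/-- `φ'` is a bit of `φ` with respect to the multiplicity free character `PS k`, where `J` is the
set of indices of the known PIMs in `PS`; `P` and `T` are the sets of projective characters and of
Brauer characters used for testing. -/
def IsMultFreeBit (B : Set (Block G p I)) {s : ℕ} (PS : Fin s → G → ℂ) (P T : Set (G → ℂ))
    (J : Set (Fin s)) (k : Fin s) (φ φ' : G → ℂ) : Prop :=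
  ∃ n n' : Fin s → ℕ,
    φ = ∑ i, n i • brauerAtoms B PS i ∧
    φ' = ∑ i, n' i • brauerAtoms B PS i ∧
    (∀ i, n' i ≤ n i) ∧
    n' k = 1 ∧
    (∀ i ∈ J, (n' i : ℕ∞) ≤ maxMult PS J T i k) ∧
    ∀ Ψ ∈ P, 0 ≤ ip φ' Ψ ∧ 0 ≤ ip (φ - φ') Ψ

end Bits

end ModChar

end

noncomputable section

/-! ### Algebraic closedness of `K` and `F`, and a place of `K` with residue field `F`. -/

namespace ModChar

open Polynomial

/-! The theorem rests on the duality between PIMs and irreducible Brauer characters (`ip_pim`). By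
it, `Σ - zΦ` is genuine as soon as `z⟨ω,Φ⟩ ≤ ⟨ω,Σ⟩` for every irreducible Brauer character `ω`
(`IsProjectiveCharacter.sub_nsmul`). Such `ω` enter the computation as bits: they pair
non-negatively with projective characters, and so does what is left after removing `ω` from a Brauer
character containing it.

In case (i) `Φ` is the PIM of some `φ`, and only `ω = φ` imposes a condition. This `φ` is a bit of
every basic character pairing positively with `Φ` (`isPimBit_constituent`), so each of the minima is
at most `⟨φ,Σ⟩`, and the largest may be taken. In case (ii) every `⟨ω,Φ⟩` is 0 or 1
(`MultiplicityFree.ip_eq_one`). An `ω` with value 1 is only known to be a bit of those basic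
characters which contain it (`isMultFreeBit_constituent`); there is at least one, but it depends on
`ω`, so the smallest minimum is taken.

The duality needs no projective modules. An irreducible Brauer character `φ` is a class function, so
`φ = ∑ ⟨φ,χ⟩ χ` (`eq_sum_ip_irr`). As `φ` vanishes on `p`-singular elements, each `χ` may be
replaced by `χ̂`, and decomposing `χ̂` gives `φ = ∑ ⟨φ,Φ_ω⟩ ω`; linear independence of `IBr`
finishes. The decomposition comes from reducing representations modulo `I` (`exists_reduction`) and
splitting off constituents (`brauerFun_mem_closure_IBr`). Both the reduction and the linear
independence use a valuation ring of `K` with residue field `F` (`exists_place`). -/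

instance instIsAlgClosedAlgNum : IsAlgClosed AlgNum :=
  (algebraicClosure.isAlgClosure ℚ ℂ).isAlgClosed

lemma mem_algInt_of_isIntegral {x : AlgNum} (hx : IsIntegral AlgInt x) :
    x ∈ integralClosure ℤ AlgNum :=
  isIntegral_trans (R := ℤ) (A := AlgInt) x hx

/-- A root exists in the algebraically closed `K`, and being integral over `R` it lies in `R`. -/
lemma exists_root_algInt {q : AlgInt[X]} (hq : q.Monic) (hd : q.natDegree ≠ 0) :
    ∃ r : AlgInt, q.eval r = 0 := by
  obtain ⟨x, hx⟩ := IsAlgClosed.exists_eval₂_eq_zero_of_injective (algebraMap AlgInt AlgNum)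
    Subtype.val_injective q (fun h => hd (natDegree_eq_zero_iff_degree_le_zero.2 h.le))
  have hxi : x ∈ integralClosure ℤ AlgNum := mem_algInt_of_isIntegral ⟨q, hq, hx⟩
  refine ⟨⟨x, hxi⟩, Subtype.val_injective ?_⟩
  have := hom_eval₂ q (RingHom.id AlgInt) (algebraMap AlgInt AlgNum) ⟨x, hxi⟩
  simp only [RingHom.comp_id] at this
  exact this.trans hx

variable {p : ℕ} {I : Ideal AlgInt} [I.IsMaximal]

instance instIsAlgClosedResField : IsAlgClosed (ResField I) := by
  refine IsAlgClosed.of_exists_root _ fun f hf hirr => ?_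
  obtain ⟨q, hq, hdeg, hmon⟩ := lifts_and_natDegree_eq_and_monic
    (f := Ideal.Quotient.mk I)
    ((mem_lifts f).2 (map_surjective _ Ideal.Quotient.mk_surjective f)) hf
  obtain ⟨r, hr⟩ := exists_root_algInt hmon (by rw [hdeg]; exact hirr.natDegree_pos.ne')
  refine ⟨Ideal.Quotient.mk I r, ?_⟩
  rw [← hq, eval_map, eval₂_hom, hr, map_zero]

lemma charP_resField (hp : p.Prime) (hpI : (p : AlgInt) ∈ I) : CharP (ResField I) p := by
  have h0 : ((p : ℕ) : ResField I) = 0 := by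
    rw [← map_natCast (Ideal.Quotient.mk I)]; exact Ideal.Quotient.eq_zero_iff_mem.2 hpI
  exact (CharP.charP_iff_prime_eq_zero hp).2 h0

/-- The reduction `R → F` extends to a valuation ring of `K` with residue field `F`. -/
theorem exists_place (hp : p.Prime) (hpI : (p : AlgInt) ∈ I) :
    ∃ (A : ValuationSubring AlgNum) (π : A →+* ResField I),
      ∀ r : AlgInt, ∃ h : (r : AlgNum) ∈ A, π ⟨r, h⟩ = Ideal.Quotient.mk I r := by
  obtain ⟨A, hA, hI⟩ := Ideal.image_subset_nonunits_valuationSubring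
    -- `A` contains `R`, and its maximal ideal contains `I`; hence `F` maps to the residue field of
    -- `A`.
    (A := (integralClosure ℤ AlgNum).toSubring) I (Ideal.IsMaximal.ne_top ‹_›)
  let ι : AlgInt →+* A := Subring.inclusion hA
  let ρ : A →+* IsLocalRing.ResidueField A := IsLocalRing.residue A
  have hker : ∀ r ∈ I, (ρ.comp ι) r = 0 := by
    intro r hr
    have h1 : ((ι r : A) : AlgNum) ∈ A.nonunits := hI ⟨r, hr, rfl⟩
    exact (IsLocalRing.residue_eq_zero_iff _).2 (ValuationSubring.coe_mem_nonunits_iff.1 h1)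
  let j : ResField I →+* IsLocalRing.ResidueField A := Ideal.Quotient.lift I (ρ.comp ι) hker
  let _ : Algebra (ResField I) (IsLocalRing.ResidueField A) := j.toAlgebra
  -- Elements of `A` are roots of primitive integer polynomials, which stay nonzero modulo `p`. So
  -- the residue field is algebraic over the algebraically closed `F`, hence equal to it.
  have hint : Algebra.IsIntegral (ResField I) (IsLocalRing.ResidueField A) := by
    refine ⟨fun y => ?_⟩
    obtain ⟨a, rfl⟩ := IsLocalRing.residue_surjective y
    have halg : IsAlgebraic ℤ (a : AlgNum) := by
      have : IsAlgebraic ℚ (a : AlgNum) := (algebraicClosure.isAlgebraic ℚ ℂ).isAlgebraic _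
      exact (IsFractionRing.isAlgebraic_iff ℤ ℚ AlgNum).2 this
    obtain ⟨f, hf0, hf⟩ := halg
    have hprim : f.primPart ≠ 0 := f.isPrimitive_primPart.ne_zero
    have hroot : aeval (a : AlgNum) f.primPart = 0 := by
      have h2 : f = C f.content * f.primPart := f.eq_C_content_mul_primPart
      rw [h2, map_mul, aeval_C, mul_eq_zero] at hf
      refine hf.resolve_left ?_
      simpa [content_eq_zero_iff] using hf0
    have hrootA : aeval a f.primPart = 0 := by
      apply Subtype.val_injective
      have := hom_eval₂ f.primPart (algebraMap ℤ A) A.subtype a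
      rw [RingHom.ext_int (A.subtype.comp (algebraMap ℤ A)) (algebraMap ℤ AlgNum)] at this
      exact this.trans hroot
    refine IsAlgebraic.isIntegral ⟨f.primPart.map (algebraMap ℤ (ResField I)), ?_, ?_⟩
    · intro h0
      have := charP_resField hp hpI
      have hdvd : ∀ n, (p : ℤ) ∣ f.primPart.coeff n := by
        intro n
        have := congrArg (fun q => coeff q n) h0
        simpa [coeff_map, CharP.intCast_eq_zero_iff (ResField I) p] using this
      have hu := f.isPrimitive_primPart (p : ℤ) ((C_dvd_iff_dvd_coeff _ _).2 hdvd)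
      exact hp.one_lt.ne' (by simpa using Int.isUnit_iff_natAbs_eq.1 hu)
    · change eval₂ j _ _ = 0
      rw [eval₂_map, RingHom.ext_int (j.comp (algebraMap ℤ (ResField I)))
        (ρ.comp (algebraMap ℤ A)), ← hom_eval₂]
      rw [← aeval_def, hrootA, map_zero]
  let e : ResField I ≃+* IsLocalRing.ResidueField A :=
    RingEquiv.ofBijective j IsAlgClosed.algebraMap_bijective_of_isIntegral
  refine ⟨A, (e.symm : IsLocalRing.ResidueField A →+* ResField I).comp ρ, fun r => ⟨hA r.2, ?_⟩⟩
  rw [RingHom.comp_apply]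
  exact e.symm_apply_apply (Ideal.Quotient.mk I r)

end ModChar

/-! ### Lifting roots of unity from `F` to `R`. -/

namespace ModChar

open Polynomial

variable {p : ℕ} {I : Ideal AlgInt}

/-- If `w = u/v` were not 1, then `1 + w + ⋯ + w^(n-1) = 0`; but `w` reduces to 1, so this sum
reduces to `n ≠ 0`. -/
lemma eq_of_reduction_eq {n : ℕ} (hn : (n : ResField I) ≠ 0) {u v : AlgInt} (hu : u ^ n = 1)
    (hv : v ^ n = 1) (h : Ideal.Quotient.mk I u = Ideal.Quotient.mk I v) : u = v := by
  have hn0 : n ≠ 0 := by rintro rfl; simp at hn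
  have hvv : v ^ (n - 1) * v = 1 := by rw [← pow_succ, Nat.sub_add_cancel (by omega), hv]
  set w := v ^ (n - 1) * u
  have hw : w ^ n = 1 := by
    rw [mul_pow, ← pow_mul, mul_comm (n - 1), pow_mul, hv, hu, one_pow, one_mul]
  have hmw : Ideal.Quotient.mk I w = 1 := by rw [map_mul, h, ← map_mul, hvv, map_one]
  suffices w = 1 by
    calc u = (v ^ (n - 1) * v) * u := by rw [hvv, one_mul]
      _ = v * w := by simp only [w]; ring
      _ = v := by rw [this, mul_one]
  by_contra hne
  have hg : ∑ i ∈ Finset.range n, w ^ i = 0 := by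
    have := mul_geom_sum w n
    rw [hw, sub_self] at this
    exact (mul_eq_zero.1 this).resolve_left (sub_ne_zero.2 hne)
  have := congrArg (Ideal.Quotient.mk I) hg
  rw [map_sum, map_zero] at this
  simp only [map_pow, hmw, one_pow, Finset.sum_const, Finset.card_range, nsmul_eq_mul,
    mul_one] at this
  exact hn this

variable [I.IsMaximal]

lemma exists_primitiveRoot_algInt {n : ℕ} (hn : n ≠ 0) : ∃ ζ : AlgInt, IsPrimitiveRoot ζ n := by
  have : NeZero (n : AlgNum) := ⟨Nat.cast_ne_zero.2 hn⟩
  obtain ⟨z, hz⟩ := HasEnoughRootsOfUnity.exists_primitiveRoot AlgNum n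
  have hzi : IsIntegral ℤ z := hz.isIntegral (Nat.pos_of_ne_zero hn)
  exact ⟨⟨z, hzi⟩, IsPrimitiveRoot.of_map_of_injective (f := algebraMap AlgInt AlgNum) hz
    Subtype.val_injective⟩

/-- `X^n - 1` already splits over `R`; reduce the factorization and evaluate it at `ζ`. -/
lemma exists_lift_of_pow_eq_one {n : ℕ} (hn : n ≠ 0) {ζ : ResField I} (hζ : ζ ^ n = 1) :
    ∃ u : AlgInt, u ^ n = 1 ∧ Ideal.Quotient.mk I u = ζ := by
  obtain ⟨z, hz⟩ := exists_primitiveRoot_algInt hn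
  have h := congrArg (fun q : AlgInt[X] => (q.map (Ideal.Quotient.mk I)).eval ζ)
    (X_pow_sub_one_eq_prod (Nat.pos_of_ne_zero hn) hz)
  simp only [Polynomial.map_sub, Polynomial.map_pow, map_X, Polynomial.map_one, eval_sub, eval_pow,
    eval_X, eval_one, Polynomial.map_prod, eval_prod, map_C, eval_C, hζ, sub_self] at h
  obtain ⟨u, hu, hu0⟩ := Finset.prod_eq_zero_iff.1 h.symm
  exact ⟨u, (mem_nthRootsFinset (Nat.pos_of_ne_zero hn) 1).1 hu, (sub_eq_zero.1 hu0).symm⟩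

section

variable {G : Type*} [Group G] [Fintype G]

lemma ordCompl_card_ne_zero : ordCompl[p] (Fintype.card G) ≠ 0 :=
  (Nat.ordCompl_pos p Fintype.card_ne_zero).ne'

lemma cast_ordCompl_card_ne_zero (hp : p.Prime) (hpI : (p : AlgInt) ∈ I) :
    ((ordCompl[p] (Fintype.card G) : ℕ) : ResField I) ≠ 0 := by
  have := charP_resField hp hpI
  rw [Ne, CharP.cast_eq_zero_iff (ResField I) p]
  exact Nat.not_dvd_ordCompl hp Fintype.card_ne_zero

lemma rootLift_spec {ζ : ResField I} (hζ : ζ ^ (ordCompl[p] (Fintype.card G)) = 1) :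
    rootLift G p I ζ ^ (ordCompl[p] (Fintype.card G)) = 1 ∧
      Ideal.Quotient.mk I (rootLift G p I ζ) = ζ := by
  have h : ∃ u ∈ {u : AlgInt | u ^ (ordCompl[p] (Fintype.card G)) = 1},
      Ideal.Quotient.mk I u = ζ := by
    obtain ⟨u, hu, hu'⟩ := exists_lift_of_pow_eq_one (I := I) ordCompl_card_ne_zero hζ
    exact ⟨u, hu, hu'⟩
  exact ⟨Function.invFunOn_mem h, Function.invFunOn_eq h⟩

lemma rootLift_mk (hp : p.Prime) (hpI : (p : AlgInt) ∈ I) {u : AlgInt}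
    (hu : u ^ (ordCompl[p] (Fintype.card G)) = 1) :
    rootLift G p I (Ideal.Quotient.mk I u) = u := by
  obtain ⟨h1, h2⟩ := rootLift_spec (G := G) (p := p) (ζ := Ideal.Quotient.mk I u)
    (by rw [← map_pow, hu, map_one])
  exact eq_of_reduction_eq (cast_ordCompl_card_ne_zero (G := G) hp hpI) h1 hu h2

lemma orderOf_dvd_ordCompl (hp : p.Prime) {g : G} (hg : ¬ p ∣ orderOf g) :
    orderOf g ∣ ordCompl[p] (Fintype.card G) := by
  have h := orderOf_dvd_card (x := g)
  rw [← Nat.ordProj_mul_ordCompl_eq_self (Fintype.card G) p] at h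
  exact (Nat.Coprime.pow_right _ ((Nat.Prime.coprime_iff_not_dvd hp).2 hg).symm).dvd_of_dvd_mul_left h

lemma pow_eq_one_of_mem_roots_charpoly {k V : Type*} [Field k] [AddCommGroup V] [Module k V]
    [FiniteDimensional k V] {T : Module.End k V} {m : ℕ} (hT : T ^ m = 1) {ζ : k}
    (hζ : ζ ∈ T.charpoly.roots) : ζ ^ m = 1 := by
  have h : T.HasEigenvalue ζ := (T.hasEigenvalue_iff_isRoot_charpoly ζ).2 (isRoot_of_mem_roots hζ)
  obtain ⟨v, hv⟩ := h.exists_hasEigenvector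
  have h2 := hv.pow_apply m
  rw [hT, Module.End.one_apply] at h2
  have h3 : (ζ ^ m - 1) • v = 0 := by rw [sub_smul, one_smul, ← h2, sub_self]
  exact sub_eq_zero.1 ((smul_eq_zero.1 h3).resolve_right hv.2)

lemma pow_ordCompl_eq_one_of_mem_roots {k V : Type*} [Field k] [AddCommGroup V] [Module k V]
    [FiniteDimensional k V] (X : Representation k G V) (hp : p.Prime) {g : G}
    (hg : ¬ p ∣ orderOf g) {ζ : k} (hζ : ζ ∈ (X g).charpoly.roots) :
    ζ ^ (ordCompl[p] (Fintype.card G)) = 1 := by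
  refine pow_eq_one_of_mem_roots_charpoly (T := X g) ?_ hζ
  rw [← map_pow, orderOf_dvd_iff_pow_eq_one.1 (orderOf_dvd_ordCompl hp hg), map_one]

/-- The value of the Brauer character at a `p`-regular element, as an algebraic integer. -/
def brauerValue (p : ℕ) (I : Ideal AlgInt) [I.IsMaximal] {V : Type*} [AddCommGroup V]
    [Module (ResField I) V] [FiniteDimensional (ResField I) V]
    (X : Representation (ResField I) G V) (g : G) : AlgInt :=
  ((X g).charpoly.roots.map (rootLift G p I)).sum

lemma brauerCharacter_apply {n : ℕ} (X : Representation (ResField I) G (Fin n → ResField I))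
    (g : G) : brauerCharacter p I X g =
      if p ∣ orderOf g then 0 else ((brauerValue p I X g : AlgNum) : ℂ) := by
  unfold brauerCharacter brauerValue
  split_ifs with h
  · rfl
  · have h1 := map_multiset_sum ((algebraMap AlgNum ℂ).comp (algebraMap AlgInt AlgNum))
      ((X g).charpoly.roots.map (rootLift G p I))
    rw [Multiset.map_map] at h1
    exact h1.symm

lemma trace_eq_sum_roots_charpoly {k V : Type*} [Field k] [IsAlgClosed k] [AddCommGroup V]
    [Module k V] [FiniteDimensional k V] (T : Module.End k V) :
    LinearMap.trace k V T = T.charpoly.roots.sum := by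
  have b := Module.finBasis k V
  rw [LinearMap.trace_eq_matrix_trace k b, Matrix.trace_eq_sum_roots_charpoly,
    LinearMap.charpoly_toMatrix]

lemma mk_brauerValue (hp : p.Prime) {V : Type*} [AddCommGroup V]
    [Module (ResField I) V] [FiniteDimensional (ResField I) V]
    (X : Representation (ResField I) G V) {g : G} (hg : ¬ p ∣ orderOf g) :
    Ideal.Quotient.mk I (brauerValue p I X g) = X.character g := by
  unfold brauerValue Representation.character
  rw [trace_eq_sum_roots_charpoly, map_multiset_sum, Multiset.map_map]
  congr 1
  conv_rhs => rw [← Multiset.map_id' (X g).charpoly.roots]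
  exact Multiset.map_congr rfl fun ζ hζ =>
    (rootLift_spec (pow_ordCompl_eq_one_of_mem_roots X hp hg hζ)).2

end

end ModChar

/-! ### Linear independence of irreducible characters in arbitrary characteristic. -/

namespace ModChar

open Polynomial

section LinearIndependence

variable {k G ι : Type*} [Field k] [IsAlgClosed k] [Group G] [Fintype ι]
  {V : ι → Type*} [∀ i, AddCommGroup (V i)] [∀ i, Module k (V i)] [∀ i, FiniteDimensional k (V i)]

/-- Pairwise inequivalent irreducible representations over an algebraically closed field can be
separated by an element of the group algebra. -/
theorem exists_asAlgebraHom_eq (X : ∀ i, Representation k G (V i)) (hX : ∀ i, (X i).IsIrreducible)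
    (hne : ∀ i j, i ≠ j → IsEmpty ((X i).Equiv (X j))) (i₀ : ι) (T : Module.End k (V i₀)) :
    ∃ r : MonoidAlgebra k G, (X i₀).asAlgebraHom r = T ∧
      ∀ j, j ≠ i₀ → (X j).asAlgebraHom r = 0 := by
  classical
  let M := ∀ i, (X i).asModule
  have hss : IsSemisimpleModule (MonoidAlgebra k G) M := inferInstance
  have hoff : ∀ i j, i ≠ j → ∀ f : (X i).asModule →ₗ[MonoidAlgebra k G] (X j).asModule, f = 0 := by
    intro i j hij f
    have := hX i
    have := hX j
    have := hne i j hij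
    have h0 : (Representation.IntertwiningMap.equivLinearMapAsModule (X i) (X j)).symm f = 0 :=
      Subsingleton.elim _ _
    simpa using h0
  have hdiag : ∀ i, ∀ f : Module.End (MonoidAlgebra k G) (X i).asModule, ∃ c : k, ∀ v, f v = c • v := by
    intro i f
    have := hX i
    obtain ⟨c, hc⟩ := (IsSimpleModule.algebraMap_end_bijective_of_isAlgClosed k
      (A := MonoidAlgebra k G) (V := (X i).asModule)).2 f
    exact ⟨c, fun v => by rw [← hc]; rfl⟩
  -- The map acting as `T` on the summand `i₀` and as 0 on the others. By Schur's lemma (`hoff`,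
  -- `hdiag`) module endomorphisms are block diagonal with scalar blocks, so `f` commutes with all
  -- of them and the density theorem applies.
  let f : Module.End (Module.End (MonoidAlgebra k G) M) M :=
    { toFun := fun v => Pi.single (M := fun i => (X i).asModule) i₀
        ((X i₀).asModuleEquiv.symm (T ((X i₀).asModuleEquiv (v i₀))))
      map_add' := fun v w => by
        change Pi.single (M := fun i => (X i).asModule) i₀
          ((X i₀).asModuleEquiv.symm (T ((X i₀).asModuleEquiv (v i₀ + w i₀)))) = _
        rw [map_add, map_add, map_add]
        exact Pi.single_add _ _ _
      map_smul' := fun φ v => by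
        obtain ⟨c, hc⟩ := hdiag i₀ ((LinearMap.proj i₀).comp (φ.comp (LinearMap.single _ _ i₀)))
        have h1 : ∀ v, φ (Pi.single (M := fun i => (X i).asModule) i₀ v) =
            Pi.single (M := fun i => (X i).asModule) i₀ (c • v) := by
          intro v
          ext j
          by_cases hj : j = i₀
          · subst hj; rw [Pi.single_eq_same]; exact hc v
          · have := LinearMap.congr_fun (hoff i₀ j (Ne.symm hj)
              ((LinearMap.proj j).comp (φ.comp (LinearMap.single _ _ i₀)))) v
            rw [Pi.single_eq_of_ne hj]; exact this
        have h2 : ∀ v : M, φ v i₀ = c • v i₀ := by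
          intro v
          conv_lhs => rw [← Finset.univ_sum_single v]
          rw [map_sum, Finset.sum_apply, Finset.sum_eq_single i₀]
          · exact (congrFun (h1 (v i₀)) i₀).trans (Pi.single_eq_same _ _)
          · intro j _ hj
            exact LinearMap.congr_fun (hoff j i₀ hj
              ((LinearMap.proj i₀).comp (φ.comp (LinearMap.single _ _ j)))) (v j)
          · simp
        change Pi.single (M := fun i => (X i).asModule) i₀
            ((X i₀).asModuleEquiv.symm (T ((X i₀).asModuleEquiv (φ v i₀)))) =
          φ (Pi.single (M := fun i => (X i).asModule) i₀
            ((X i₀).asModuleEquiv.symm (T ((X i₀).asModuleEquiv (v i₀)))))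
        rw [h1, h2]
        simp }
  -- The basis vectors of all summands: agreement on them determines every operator involved.
  let s : Finset M := Finset.univ.biUnion fun i => Finset.univ.image fun a =>
    Pi.single (M := fun i => (X i).asModule) i
      ((X i).asModuleEquiv.symm (Module.finBasis k (V i) a))
  obtain ⟨r, hr⟩ := jacobson_density f s
  have key : ∀ i a, ((f (Pi.single (M := fun i => (X i).asModule) i
      ((X i).asModuleEquiv.symm (Module.finBasis k (V i) a)))) i) =
      (X i).asModuleEquiv.symm ((X i).asAlgebraHom r (Module.finBasis k (V i) a)) := by
    intro i a
    rw [hr _ (Finset.mem_biUnion.2 ⟨i, Finset.mem_univ _, Finset.mem_image_of_mem _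
      (Finset.mem_univ a)⟩), Pi.smul_apply, Pi.single_eq_same]
    rw [LinearEquiv.eq_symm_apply, Representation.asModuleEquiv_map_smul,
      LinearEquiv.apply_symm_apply]
  refine ⟨r, (Module.finBasis k (V i₀)).ext fun a => ?_, fun j hj =>
    (Module.finBasis k (V j)).ext fun a => ?_⟩
  · have := key i₀ a
    simpa [f] using this.symm
  · have := key j a
    simpa [f, Pi.single_eq_of_ne hj] using this.symm

/-- Extend the relation linearly to the group algebra and evaluate it at an element acting as a
rank-one operator of trace 1 on one representation and as 0 on the others. The identity would not
do: its trace may vanish in characteristic `p`. -/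
theorem coeff_eq_zero_of_sum_character_eq_zero (X : ∀ i, Representation k G (V i))
    (hX : ∀ i, (X i).IsIrreducible) (hne : ∀ i j, i ≠ j → IsEmpty ((X i).Equiv (X j)))
    {c : ι → k} (hc : ∀ g, ∑ i, c i * (X i).character g = 0) (i₀ : ι) : c i₀ = 0 := by
  classical
  have hlin : ∀ r : MonoidAlgebra k G,
      ∑ i, c i * LinearMap.trace k (V i) ((X i).asAlgebraHom r) = 0 := by
    intro r
    have h : (∑ i, c i • (LinearMap.trace k (V i)).comp (X i).asAlgebraHom.toLinearMap) = 0 := by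
      refine MonoidAlgebra.lhom_ext' fun g => LinearMap.ext_ring ?_
      simpa [Representation.asAlgebraHom_single, Representation.character] using hc g
    simpa using LinearMap.congr_fun h r
  have := hX i₀
  have : Nontrivial (V i₀) := by
    have := IsSimpleModule.nontrivial (MonoidAlgebra k G) (X i₀).asModule
    exact (X i₀).asModuleEquiv.symm.toEquiv.nontrivial
  obtain ⟨v, hv⟩ := exists_ne (0 : V i₀)
  obtain ⟨l, hl⟩ : ∃ l : Module.Dual k (V i₀), l v = 1 := by
    by_contra! h
    refine hv ((Module.forall_dual_apply_eq_zero_iff k v).1 fun l => ?_)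
    by_contra h0
    exact h ((l v)⁻¹ • l) (by simp [h0])
  obtain ⟨r, hr, hr0⟩ := exists_asAlgebraHom_eq X hX hne i₀ (l.smulRight v)
  have h := hlin r
  rw [Finset.sum_eq_single i₀ (fun j _ hj => by rw [hr0 j hj]; simp) (by simp), hr,
    LinearMap.trace_smulRight, hl, mul_one] at h
  exact h

end LinearIndependence

end ModChar

/-! ### Linear independence of irreducible Brauer characters. -/

namespace ModChar

open Polynomial

lemma charpoly_eq_of_equiv {k H V W : Type*} [Field k] [Group H] [AddCommGroup V] [Module k V]
    [FiniteDimensional k V] [AddCommGroup W] [Module k W] [FiniteDimensional k W]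
    {X : Representation k H V} {Y : Representation k H W} (e : X.Equiv Y) (g : H) :
    (X g).charpoly = (Y g).charpoly := by
  rw [← e.conj_apply_self g]
  exact (LinearEquiv.charpoly_conj _ _).symm

section CharP

variable {k : Type*} [Field k] (p b : ℕ) [Fact p.Prime] [CharP k p]

/-- After the injective substitution `X ↦ X^(p^b)`, both sides become the `p^b`-th power of
`M.charpoly`, because `(X - M)^(p^b) = X^(p^b) - M^(p^b)` in characteristic `p`. -/
lemma charpoly_pow_prime_pow {n : Type*} [Fintype n] [DecidableEq n] (M : Matrix n n k) :
    (M ^ p ^ b).charpoly = M.charpoly.map (iterateFrobenius k p b) := by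
  have hq : p ^ b ≠ 0 := pow_ne_zero _ (Fact.out : p.Prime).ne_zero
  cases isEmpty_or_nonempty n
  · simp [Matrix.charpoly, Matrix.det_isEmpty]
  apply expand_injective (Nat.pos_of_ne_zero hq)
  have h1 : M.charpoly ^ p ^ b = expand k (p ^ b) (M.charpoly.map (iterateFrobenius k p b)) := by
    rw [← map_expand]
    exact (map_iterateFrobenius_expand p M.charpoly b).symm
  rw [← h1]
  unfold Matrix.charpoly
  rw [AlgHom.map_det, ← Matrix.coe_detMonoidHom,
    ← (Matrix.detMonoidHom : Matrix n n k[X] →* k[X]).map_pow]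
  apply congr_arg Matrix.det
  refine matPolyEquiv.injective ?_
  rw [map_pow, Matrix.matPolyEquiv_charmatrix, sub_pow_char_pow_of_commute, ← C_pow]
  · exact (id (matPolyEquiv_eq_X_pow_sub_C (p ^ b) M) :)
  · exact (C M).commute_X

lemma trace_pow_prime_pow {V : Type*} [AddCommGroup V] [Module k V] [FiniteDimensional k V]
    (T : Module.End k V) :
    LinearMap.trace k V (T ^ p ^ b) = LinearMap.trace k V T ^ p ^ b := by
  have B := Module.finBasis k V
  rw [LinearMap.trace_eq_matrix_trace k B, LinearMap.trace_eq_matrix_trace k B,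
    ← LinearMap.toMatrix_pow, Matrix.trace_eq_neg_charpoly_nextCoeff,
    Matrix.trace_eq_neg_charpoly_nextCoeff, charpoly_pow_prime_pow p b,
    nextCoeff_map (iterateFrobenius k p b).injective, ← iterateFrobenius_def, map_neg]

/-- `h` is the `p'`-part of `g`: with `p^b` the `p`-part of the order, raising to the `p^b`-th power
is invertible on the group generated by `g^(p^b)`. -/
lemma exists_regular_pow_eq {G : Type*} [Group G] [Finite G] (g : G) :
    ∃ (h : G) (b : ℕ), ¬ p ∣ orderOf h ∧ h ^ p ^ b = g ^ p ^ b := by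
  have hp : p.Prime := Fact.out
  set b := (orderOf g).factorization p
  have ho : orderOf (g ^ p ^ b) = ordCompl[p] (orderOf g) :=
    orderOf_pow_of_dvd (pow_ne_zero _ hp.ne_zero) (Nat.ordProj_dvd _ _)
  have hnd : ¬ p ∣ orderOf (g ^ p ^ b) := by
    rw [ho]; exact Nat.not_dvd_ordCompl hp (orderOf_pos g).ne'
  obtain ⟨m, hm⟩ := exists_pow_eq_self_of_coprime (x := g ^ p ^ b) (n := p ^ b)
    (Nat.Coprime.pow_left _ ((Nat.Prime.coprime_iff_not_dvd hp).2 hnd))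
  refine ⟨(g ^ p ^ b) ^ m, b, fun h => hnd (h.trans (orderOf_pow_dvd m)), ?_⟩
  rw [← pow_mul, mul_comm m, pow_mul, hm]

/-- The trace of a `p^b`-th power is the `p^b`-th power of the trace, and Frobenius is injective.
Thus characters over `F` are determined by their values on `p`-regular elements. -/
lemma character_eq_of_pow_eq {G V : Type*} [Group G] [AddCommGroup V] [Module k V]
    [FiniteDimensional k V] (X : Representation k G V) {g h : G} (H : h ^ p ^ b = g ^ p ^ b) :
    X.character h = X.character g := by
  apply (iterateFrobenius k p b).injective
  simp only [iterateFrobenius_def, Representation.character]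
  rw [← trace_pow_prime_pow, ← trace_pow_prime_pow, ← map_pow, ← map_pow, H]

end CharP

variable {p : ℕ} {I : Ideal AlgInt} [I.IsMaximal] {G : Type*} [Group G] [Fintype G]

section

variable {ι : Type*} [Fintype ι] {V : ι → Type*} [∀ i, AddCommGroup (V i)]
  [∀ i, Module (ResField I) (V i)] [∀ i, FiniteDimensional (ResField I) (V i)]

/-- Divide a nontrivial relation by a coefficient of largest valuation: it then has coefficients in
`A`, one of them 1, and reduces to a nontrivial relation among irreducible `F`-characters on
`p`-regular elements, hence on all of `G`. -/
lemma coeff_eq_zero_of_sum_brauerValue_algNum (hp : p.Prime) (hpI : (p : AlgInt) ∈ I)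
    (X : ∀ i, Representation (ResField I) G (V i)) (hX : ∀ i, (X i).IsIrreducible)
    (hne : ∀ i j, i ≠ j → IsEmpty ((X i).Equiv (X j))) {c : ι → AlgNum}
    (hc : ∀ g, ¬ p ∣ orderOf g → ∑ i, c i * (brauerValue p I (X i) g : AlgNum) = 0) : c = 0 := by
  obtain ⟨A, π, hπ⟩ := exists_place hp hpI
  have := charP_resField hp hpI
  have : Fact p.Prime := ⟨hp⟩
  by_contra hne0
  obtain ⟨j, hj⟩ : ∃ j, c j ≠ 0 := by
    by_contra! h
    exact hne0 (funext h)
  obtain ⟨i₀, -, hmax⟩ := Finset.exists_max_image Finset.univ (fun i => A.valuation (c i))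
    ⟨j, Finset.mem_univ j⟩
  have h0 : c i₀ ≠ 0 := by
    intro h
    have := hmax j (Finset.mem_univ j)
    rw [h, map_zero] at this
    exact hj ((map_eq_zero A.valuation).1 (le_zero_iff.1 this))
  have hmem : ∀ i, c i / c i₀ ∈ A := by
    intro i
    rw [← A.valuation_le_one_iff, map_div₀]
    exact div_le_one_of_le₀ (hmax i (Finset.mem_univ i)) zero_le
  have hreg : ∀ g, ¬ p ∣ orderOf g → ∑ i, π ⟨c i / c i₀, hmem i⟩ * (X i).character g = 0 := by
    intro g hg
    have h1 : ∑ i, (⟨c i / c i₀, hmem i⟩ : A) * ⟨_, (hπ (brauerValue p I (X i) g)).1⟩ = 0 := by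
      apply Subtype.val_injective
      have h2 := congrArg (fun x => (c i₀)⁻¹ * x) (hc g hg)
      simp only [Finset.mul_sum, mul_zero] at h2
      rw [← A.subtype_apply, map_sum]
      refine Eq.trans (Finset.sum_congr rfl fun i _ => ?_) h2
      rw [map_mul, A.subtype_apply, A.subtype_apply]
      change c i / c i₀ * _ = _
      rw [div_eq_mul_inv]; ring
    have h3 := congrArg π h1
    rw [map_sum, map_zero] at h3
    rw [← h3]
    refine Finset.sum_congr rfl fun i _ => ?_
    rw [map_mul, (hπ (brauerValue p I (X i) g)).2, mk_brauerValue hp _ hg]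
  have hall : ∀ g, ∑ i, π ⟨c i / c i₀, hmem i⟩ * (X i).character g = 0 := by
    intro g
    obtain ⟨h, b, hh, hb⟩ := exists_regular_pow_eq p g
    rw [← hreg h hh]
    exact Finset.sum_congr rfl fun i _ => by rw [character_eq_of_pow_eq p b (X i) hb]
  have h1 := coeff_eq_zero_of_sum_character_eq_zero X hX hne hall i₀
  have h2 : (⟨c i₀ / c i₀, hmem i₀⟩ : A) = 1 := Subtype.ext (div_self h0)
  rw [h2, map_one] at h1
  exact one_ne_zero h1

/-- The Brauer characters of pairwise inequivalent irreducible representations are linearly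
independent over `ℂ`. -/
theorem coeff_eq_zero_of_sum_brauerValue (hp : p.Prime) (hpI : (p : AlgInt) ∈ I)
    (X : ∀ i, Representation (ResField I) G (V i)) (hX : ∀ i, (X i).IsIrreducible)
    (hne : ∀ i j, i ≠ j → IsEmpty ((X i).Equiv (X j))) {c : ι → ℂ}
    (hc : ∀ g, ¬ p ∣ orderOf g → ∑ i, c i * ((brauerValue p I (X i) g : AlgNum) : ℂ) = 0) :
    c = 0 := by
  funext i
  -- The Brauer values lie in `K`, so any `K`-linear functional on `ℂ` turns the relation into one
  -- over `K`; such functionals detect zero.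
  refine (Module.forall_dual_apply_eq_zero_iff AlgNum (c i)).1 fun l => ?_
  refine congrFun (coeff_eq_zero_of_sum_brauerValue_algNum hp hpI X hX hne
    (c := fun i => l (c i)) fun g hg => ?_) i
  rw [← map_zero l, ← hc g hg, map_sum]
  refine Finset.sum_congr rfl fun i _ => ?_
  have : c i * ((brauerValue p I (X i) g : AlgNum) : ℂ) = (brauerValue p I (X i) g : AlgNum) • c i := by
    rw [mul_comm]; rfl
  rw [this, map_smul, smul_eq_mul, mul_comm]

end

lemma brauerValue_eq_of_equiv {V W : Type*} [AddCommGroup V] [Module (ResField I) V]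
    [FiniteDimensional (ResField I) V] [AddCommGroup W] [Module (ResField I) W]
    [FiniteDimensional (ResField I) W] {X : Representation (ResField I) G V}
    {Y : Representation (ResField I) G W} (e : X.Equiv Y) :
    brauerValue p I X = brauerValue p I Y := by
  funext g
  unfold brauerValue
  rw [charpoly_eq_of_equiv e g]

theorem linearIndependent_IBr (hp : p.Prime) (hpI : (p : AlgInt) ∈ I) :
    LinearIndependent ℂ (fun φ : IBr G p I => (φ : G → ℂ)) := by
  rw [linearIndependent_iff']
  intro s c hc
  choose n X hX hφ using fun φ : IBr G p I => φ.2
  have h := coeff_eq_zero_of_sum_brauerValue (ι := s) hp hpI (fun i => X i) (fun i => hX i) ?_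
    (c := fun i => c i) ?_
  · exact fun i hi => congrFun h ⟨i, hi⟩
  · intro i j hij
    refine ⟨fun e => hij (Subtype.ext (Subtype.ext ?_))⟩
    funext g
    rw [hφ, hφ j, brauerCharacter_apply, brauerCharacter_apply, brauerValue_eq_of_equiv e]
  · intro g hg
    have h1 := congrFun hc g
    rw [Finset.sum_apply, ← Finset.sum_coe_sort] at h1
    refine Eq.trans (Finset.sum_congr rfl fun i _ => ?_) h1
    rw [Pi.smul_apply, hφ, brauerCharacter_apply, if_neg hg, smul_eq_mul]

lemma finite_IBr (hp : p.Prime) (hpI : (p : AlgInt) ∈ I) : Finite (IBr G p I) :=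
  (linearIndependent_IBr hp hpI).finite

end ModChar

/-! ### Brauer characters as sums of irreducible ones. -/

namespace ModChar

open Polynomial

/-- In a basis adapted to `W` and `V ⧸ W` the matrix of `e` is block triangular. -/
lemma charpoly_eq_charpoly_restrict_mul_charpoly_mapQ {k V : Type*} [Field k] [AddCommGroup V]
    [Module k V] [FiniteDimensional k V] (W : Submodule k V) (e : V →ₗ[k] V)
    (he : W ≤ W.comap e) :
    e.charpoly = (e.restrict he).charpoly * (W.mapQ W e he).charpoly := by
  classical
  let bW := Module.finBasis k W
  let bQ := Module.finBasis k (V ⧸ W)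
  let b := Module.Basis.sumQuot bW bQ
  let B : Matrix (Fin (Module.finrank k W)) (Fin (Module.finrank k (V ⧸ W))) k :=
    Matrix.of fun i l => b.repr (e (b (Sum.inr l))) (Sum.inl i)
  suffices LinearMap.toMatrix b b e = Matrix.fromBlocks
      (LinearMap.toMatrix bW bW (e.restrict he)) B 0
      (LinearMap.toMatrix bQ bQ (W.mapQ W e he)) by
    rw [← LinearMap.charpoly_toMatrix e b, this, Matrix.charpoly_fromBlocks_zero₂₁,
      LinearMap.charpoly_toMatrix, LinearMap.charpoly_toMatrix]
  ext u v
  cases u with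
  | inl i =>
    cases v with
    | inl l =>
      simp only [b, Module.Basis.sumQuot_inl, Matrix.fromBlocks_apply₁₁, LinearMap.toMatrix_apply]
      apply Module.Basis.sumQuot_repr_inl_of_mem
    | inr l => simp [b, LinearMap.toMatrix_apply, Matrix.fromBlocks_apply₁₂, B]
  | inr j =>
    cases v with
    | inl l =>
      suffices W.mkQ (e (bW l)) = 0 by simp [LinearMap.toMatrix_apply, b, this]
      rw [← LinearMap.mem_ker, Submodule.ker_mkQ]
      exact he (bW l).2
    | inr l =>
      simp only [LinearMap.toMatrix_apply, Matrix.fromBlocks_apply₂₂, b,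
        Module.Basis.sumQuot_repr_inr, ← Module.Basis.sumQuot_inr bW bQ l, Submodule.mapQ_apply]
      rfl

section Transport

variable {k H V W : Type*} [Field k] [Group H] [AddCommGroup V] [Module k V] [AddCommGroup W]
  [Module k W]

/-- Transport of a representation along a linear equivalence. -/
def conjRep (X : Representation k H V) (e : V ≃ₗ[k] W) : Representation k H W :=
  (e.conjAlgEquiv k : Module.End k V →* Module.End k W).comp X

/-- The equivalence between a representation and its transport. -/
def conjRepEquiv (X : Representation k H V) (e : V ≃ₗ[k] W) : X.Equiv (conjRep X e) :=
  .mk e fun g => by ext v; simp [conjRep]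

lemma isIrreducible_of_equiv {X : Representation k H V} {Y : Representation k H W}
    (e : X.Equiv Y) (hX : X.IsIrreducible) : Y.IsIrreducible := by
  rw [Representation.irreducible_iff_isSimpleModule_asModule] at hX ⊢
  exact (LinearEquiv.ofBijective (Representation.IntertwiningMap.equivLinearMapAsModule X Y
    e.toIntertwiningMap) e.toLinearEquiv.bijective).isSimpleModule_iff.1 hX

end Transport

variable {p : ℕ} {I : Ideal AlgInt} [I.IsMaximal] {G : Type*} [Group G] [Fintype G]

/-- The Brauer character of a representation on an arbitrary space. -/
def brauerFun (p : ℕ) (I : Ideal AlgInt) [I.IsMaximal] {V : Type*} [AddCommGroup V]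
    [Module (ResField I) V] [FiniteDimensional (ResField I) V]
    (X : Representation (ResField I) G V) : G → ℂ :=
  fun g => if p ∣ orderOf g then 0 else ((brauerValue p I X g : AlgNum) : ℂ)

lemma brauerCharacter_eq_brauerFun {n : ℕ}
    (X : Representation (ResField I) G (Fin n → ResField I)) :
    brauerCharacter p I X = brauerFun p I X :=
  funext (brauerCharacter_apply X)

lemma exists_brauerCharacter_eq_brauerFun {V : Type*} [AddCommGroup V]
    [Module (ResField I) V] [FiniteDimensional (ResField I) V]
    (X : Representation (ResField I) G V) :
    ∃ (n : ℕ) (Y : Representation (ResField I) G (Fin n → ResField I)), Nonempty (X.Equiv Y) ∧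
      brauerCharacter p I Y = brauerFun p I X := by
  let e := (Module.finBasis (ResField I) V).equivFun
  refine ⟨_, conjRep X e, ⟨conjRepEquiv X e⟩, ?_⟩
  rw [brauerCharacter_eq_brauerFun]
  unfold brauerFun
  rw [brauerValue_eq_of_equiv (conjRepEquiv X e)]

lemma brauerFun_eq_add {V : Type*} [AddCommGroup V]
    [Module (ResField I) V] [FiniteDimensional (ResField I) V]
    (X : Representation (ResField I) G V) (W : Submodule (ResField I) V)
    (hW : ∀ g, W ≤ W.comap (X g)) :
    brauerFun p I X =
      brauerFun p I (X.subrepresentation W hW) + brauerFun p I (X.quotient W hW) := by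
  funext g
  rw [Pi.add_apply]
  unfold brauerFun
  split_ifs
  · simp
  · have h : (X g).charpoly = ((X.subrepresentation W hW) g).charpoly *
        ((X.quotient W hW) g).charpoly :=
      charpoly_eq_charpoly_restrict_mul_charpoly_mapQ W (X g) (hW g)
    unfold brauerValue
    rw [h, roots_mul (mul_ne_zero (LinearMap.charpoly_monic _).ne_zero
      (LinearMap.charpoly_monic _).ne_zero), Multiset.map_add, Multiset.sum_add]
    rfl

/-- Induction on the dimension: a proper nonzero subrepresentation and its quotient are both
smaller, and Brauer characters add up along them. -/
theorem brauerFun_mem_closure_IBr {V : Type*} [AddCommGroup V]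
    [Module (ResField I) V] [FiniteDimensional (ResField I) V]
    (X : Representation (ResField I) G V) :
    brauerFun p I X ∈ AddSubmonoid.closure (IBr G p I) := by
  induction hd : Module.finrank (ResField I) V using Nat.strong_induction_on generalizing V with
  | _ d ih =>
  rcases subsingleton_or_nontrivial V with hV | hV
  · have : brauerFun p I X = 0 := by
      funext g
      unfold brauerFun brauerValue
      have h1 : (X g).charpoly = 1 := by
        apply eq_one_of_monic_natDegree_zero (LinearMap.charpoly_monic _)
        rw [LinearMap.charpoly_natDegree, Module.finrank_zero_of_subsingleton]
      simp [h1]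
    rw [this]
    exact zero_mem _
  by_cases hX : X.IsIrreducible
  · obtain ⟨n, Y, ⟨e⟩, hY⟩ := exists_brauerCharacter_eq_brauerFun (p := p) X
    exact AddSubmonoid.subset_closure ⟨n, Y, isIrreducible_of_equiv e hX, hY.symm⟩
  · obtain ⟨U, hU1, hU2⟩ : ∃ U : Subrepresentation X, U ≠ ⊥ ∧ U ≠ ⊤ := by
      by_contra! h
      have : Nontrivial (Subrepresentation X) := by
        refine ⟨⊥, ⊤, fun hbt => ?_⟩
        have h2 := congrArg Subrepresentation.toSubmodule hbt
        exact bot_ne_top (α := Submodule (ResField I) V) h2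
      exact hX ⟨fun U => or_iff_not_imp_left.2 (h U)⟩
    have hlt : U.toSubmodule < ⊤ :=
      lt_top_iff_ne_top.2 fun h => hU2 (Subrepresentation.toSubmodule_injective h)
    have hpos : 0 < Module.finrank (ResField I) U.toSubmodule := by
      rw [Module.finrank_pos_iff, Submodule.nontrivial_iff_ne_bot]
      exact fun h => hU1 (Subrepresentation.toSubmodule_injective h)
    have hadd := U.toSubmodule.finrank_quotient_add_finrank
    rw [brauerFun_eq_add X U.toSubmodule fun g v hv => U.apply_mem_toSubmodule g hv]
    exact add_mem (ih _ (hd ▸ Submodule.finrank_lt hlt.ne) _ rfl) (ih _ (by omega) _ rfl)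

end ModChar

/-! ### Reduction of ordinary representations modulo `I`. -/

namespace ModChar

open Polynomial

section Lattice

variable {K G : Type*} [Field K] [Group G] [Finite G]

/-- A representation over a valued field can be written over the valuation ring. -/
theorem exists_integral_form (A : ValuationSubring K) {V : Type*} [AddCommGroup V] [Module K V]
    [FiniteDimensional K V] (X : Representation K G V) :
    ∃ (n : ℕ) (b : Module.Basis (Fin n) K V) (M : G →* Matrix (Fin n) (Fin n) A),
      ∀ g, LinearMap.toMatrix b b (X g) = (M g).map A.subtype := by
  classical
  let e := Module.finBasis K V
  -- The `G`-translates of a basis; their `A`-span `L` is a finitely generated `G`-stable lattice.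
  let S : Set V := Set.range fun x : G × Fin (Module.finrank K V) => X x.1 (e x.2)
  let L : Submodule A V := Submodule.span A S
  have hS : S.Finite := Set.finite_range _
  have hfin : Module.Finite A L := Module.Finite.span_of_finite A hS
  have htf : Submodule.torsion A L = ⊥ := by
    rw [eq_bot_iff]
    rintro x ⟨⟨a, ha⟩, hx⟩
    have h : (a : K) • (x : V) = 0 := congrArg L.subtype hx
    have ha0 : (a : K) ≠ 0 := fun h0 => nonZeroDivisors.ne_zero ha (Subtype.ext h0)
    exact Subtype.ext ((smul_eq_zero.1 h).resolve_left ha0)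
  -- Over the Bézout ring `A` torsion-free means flat, and over a local ring finitely generated flat
  -- means free.
  have hflat : Module.Flat A L := Module.Flat.flat_iff_torsion_eq_bot_of_isBezout.2 htf
  have hfree : Module.Free A L := Module.free_of_flat_of_isLocalRing
  let b₀ := Module.finBasis A L
  let v : Fin (Module.finrank A L) → V := fun i => b₀ i
  have hli : LinearIndependent K v := by
    rw [← LinearIndependent.iff_fractionRing A K]
    exact b₀.linearIndependent.map' L.subtype (Submodule.ker_subtype L)
  have hLspan : ∀ x ∈ L, x ∈ Submodule.span K (Set.range v) := by
    intro x hx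
    have h := b₀.sum_repr ⟨x, hx⟩
    have h2 := congrArg L.subtype h
    rw [map_sum] at h2
    change _ = x at h2
    rw [← h2]
    refine Submodule.sum_mem _ fun i _ => ?_
    rw [map_smul]
    exact Submodule.smul_mem _ ((b₀.repr ⟨x, hx⟩ i : A) : K) (Submodule.subset_span ⟨i, rfl⟩)
  have hspan : ⊤ ≤ Submodule.span K (Set.range v) := by
    rw [← e.span_eq, Submodule.span_le]
    rintro _ ⟨i, rfl⟩
    exact hLspan _ (Submodule.subset_span ⟨(1, i), by simp⟩)
  let b := Module.Basis.mk hli hspan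
  have hb : ∀ i, b i = b₀ i := fun i => Module.Basis.mk_apply hli hspan i
  have hinv : ∀ g, ∀ x ∈ L, X g x ∈ L := by
    intro g x hx
    induction hx using Submodule.span_induction with
    | mem x hx =>
      obtain ⟨⟨h, i⟩, rfl⟩ := hx
      exact Submodule.subset_span ⟨(g * h, i), by simp⟩
    | zero => rw [map_zero]; exact zero_mem _
    | add x y _ _ hx hy => rw [map_add]; exact add_mem hx hy
    | smul a x _ hx =>
      have : X g (a • x) = a • X g x := (X g).map_smul (a : K) x
      rw [this]
      exact Submodule.smul_mem _ _ hx
  let Y : G →* Module.End A L :=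
    { toFun := fun g => ((X g).restrictScalars A).restrict (hinv g)
      map_one' := by ext x; simp
      map_mul' := fun g h => by
        ext x
        exact LinearMap.congr_fun (map_mul X g h) (x : V) }
  refine ⟨_, b, (LinearMap.toMatrixAlgEquiv b₀ : Module.End A L →* _).comp Y, fun g => ?_⟩
  ext i j
  rw [LinearMap.toMatrix_apply]
  have h1 : X g (b j) = ∑ l, ((b₀.repr (Y g (b₀ j)) l : A) : K) • b l := by
    have h2 := congrArg L.subtype (b₀.sum_repr (Y g (b₀ j)))
    rw [map_sum] at h2
    rw [hb]
    refine h2.symm.trans (Finset.sum_congr rfl fun l _ => ?_)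
    rw [map_smul, hb]
    rfl
  rw [h1, b.repr_sum_self]
  simp [LinearMap.toMatrixAlgEquiv_apply]

end Lattice

variable {p : ℕ} {I : Ideal AlgInt} [I.IsMaximal] {G : Type*} [Group G] [Fintype G]

/-- Every ordinary representation has a reduction modulo `I`, whose Brauer character is the
restriction of the ordinary character. -/
theorem exists_reduction (hp : p.Prime) (hpI : (p : AlgInt) ∈ I) {V : Type*} [AddCommGroup V]
    [Module AlgNum V] [FiniteDimensional AlgNum V] (X : Representation AlgNum G V) :
    ∃ (n : ℕ) (Z : Representation (ResField I) G (Fin n → ResField I)),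
      ∀ g, ¬ p ∣ orderOf g → (brauerValue p I Z g : AlgNum) = X.character g := by
  classical
  obtain ⟨A, π, hπ⟩ := exists_place hp hpI
  obtain ⟨n, b, M, hM⟩ := exists_integral_form A X
  let Z : Representation (ResField I) G (Fin n → ResField I) :=
    (Matrix.toLinAlgEquiv' : Matrix (Fin n) (Fin n) (ResField I) ≃ₐ[ResField I] _).toMonoidHom.comp
      ((π.mapMatrix : Matrix (Fin n) (Fin n) A →+* _).toMonoidHom.comp M)
  refine ⟨n, Z, fun g hg => ?_⟩
  have hZ : (Z g).charpoly = (M g).charpoly.map π := by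
    rw [← Matrix.charpoly_map]
    exact Matrix.charpoly_toLin' _
  have hX : (X g).charpoly = (M g).charpoly.map A.subtype := by
    rw [← Matrix.charpoly_map, ← hM, LinearMap.charpoly_toMatrix]
  let j : AlgInt →+* A :=
    { toFun := fun r => ⟨r, (hπ r).1⟩
      map_one' := rfl
      map_mul' := fun _ _ => rfl
      map_zero' := rfl
      map_add' := fun _ _ => rfl }
  -- The eigenvalues of `X g` are roots of unity, so they form a multiset in `R`.
  obtain ⟨W, hW⟩ : ∃ W : Multiset AlgInt, W.map (algebraMap AlgInt AlgNum) = (X g).charpoly.roots := by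
    refine CanLift.prf (β := Multiset AlgInt) (X g).charpoly.roots fun u hu => ?_
    have h := pow_ordCompl_eq_one_of_mem_roots X hp hg hu
    have hu' : IsIntegral ℤ u := IsIntegral.of_pow (Nat.pos_of_ne_zero ordCompl_card_ne_zero) 
      (by rw [h]; exact isIntegral_one)
    exact hu'
  have hWpow : ∀ w ∈ W, w ^ (ordCompl[p] (Fintype.card G)) = 1 := by
    intro w hw
    have h := pow_ordCompl_eq_one_of_mem_roots X hp hg (hW ▸ Multiset.mem_map_of_mem _ hw)
    exact Subtype.val_injective h
  -- The factorization holds already over `A`, so applying `π` shows that the eigenvalues of `Z g`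
  -- are the reductions of `W`; `rootLift` then recovers `W` itself.
  have hsplit : (M g).charpoly = (W.map fun w => Polynomial.X - C (j w)).prod := by
    apply map_injective A.subtype Subtype.val_injective
    rw [← hX, Polynomial.map_multiset_prod, Multiset.map_map]
    conv_lhs => rw [(IsAlgClosed.splits (X g).charpoly).eq_prod_roots_of_monic
      (LinearMap.charpoly_monic _), ← hW, Multiset.map_map]
    congr 1
    refine Multiset.map_congr rfl fun w _ => ?_
    simp only [Function.comp_apply, Polynomial.map_sub, map_X, map_C]
    rfl
  have hroots : (Z g).charpoly.roots = W.map (Ideal.Quotient.mk I) := by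
    rw [hZ, hsplit, Polynomial.map_multiset_prod, Multiset.map_map]
    rw [← roots_multiset_prod_X_sub_C (W.map (Ideal.Quotient.mk I)), Multiset.map_map]
    congr 2
    refine Multiset.map_congr rfl fun w _ => ?_
    simp only [Function.comp_apply, Polynomial.map_sub, map_X, map_C]
    rw [← (hπ w).2]
    rfl
  have hval : brauerValue p I Z g = W.sum := by
    unfold brauerValue
    rw [hroots, Multiset.map_map]
    congr 1
    conv_rhs => rw [← Multiset.map_id' W]
    exact Multiset.map_congr rfl fun w hw => rootLift_mk hp hpI (hWpow w hw)
  rw [hval, Representation.character, trace_eq_sum_roots_charpoly, ← hW]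
  exact map_multiset_sum (algebraMap AlgInt AlgNum) W

end ModChar

/-! ### Orthogonality and completeness of the ordinary irreducible characters. -/

namespace ModChar

section InnerProduct

variable {G : Type*} [Fintype G]

/-- `ip` as a sesquilinear form. -/
def ipForm (G : Type*) [Fintype G] : (G → ℂ) →ₗ[ℂ] (G → ℂ) →ₛₗ[starRingEnd ℂ] ℂ :=
  LinearMap.mk₂'ₛₗ (RingHom.id ℂ) (starRingEnd ℂ) ip
    (fun a b c => by simp [ip, add_mul, Finset.sum_add_distrib, mul_add])
    (fun c a b => by simp [ip, Finset.mul_sum, mul_assoc, mul_left_comm])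
    (fun a b c => by simp [ip, Finset.sum_add_distrib, mul_add])
    (fun c a b => by simp [ip, Finset.mul_sum, mul_left_comm])

lemma ip_add_left (a b c : G → ℂ) : ip (a + b) c = ip a c + ip b c := (ipForm G).map_add₂ a b c

lemma ip_sub_left (a b c : G → ℂ) : ip (a - b) c = ip a c - ip b c := (ipForm G).map_sub₂ a b c

lemma ip_smul_left (r : ℂ) (a c : G → ℂ) : ip (r • a) c = r * ip a c := (ipForm G).map_smul₂ r a c

lemma ip_sum_left {ι : Type*} (s : Finset ι) (a : ι → G → ℂ) (c : G → ℂ) :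
    ip (∑ i ∈ s, a i) c = ∑ i ∈ s, ip (a i) c := (ipForm G).map_sum₂ s a c

lemma ip_add_right (a b c : G → ℂ) : ip a (b + c) = ip a b + ip a c := (ipForm G a).map_add b c

lemma ip_sub_right (a b c : G → ℂ) : ip a (b - c) = ip a b - ip a c := (ipForm G a).map_sub b c

lemma ip_smul_right (r : ℂ) (a c : G → ℂ) : ip a (r • c) = (starRingEnd ℂ) r * ip a c :=
  (ipForm G a).map_smulₛₗ r c

lemma ip_sum_right {ι : Type*} (s : Finset ι) (a : G → ℂ) (c : ι → G → ℂ) :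
    ip a (∑ i ∈ s, c i) = ∑ i ∈ s, ip a (c i) := map_sum (ipForm G a) c s

lemma conj_ip (a b : G → ℂ) : (starRingEnd ℂ) (ip a b) = ip b a := by
  simp [ip, mul_comm]

end InnerProduct

lemma exists_ordinaryCharacter_mem_Irr {H V : Type*} [Group H] [AddCommGroup V] [Module AlgNum V]
    [FiniteDimensional AlgNum V] {X : Representation AlgNum H V} (hX : X.IsIrreducible) :
    (fun g => ((X.character g : AlgNum) : ℂ)) ∈ Irr H := by
  let e := (Module.finBasis AlgNum V).equivFun
  refine ⟨_, conjRep X e, isIrreducible_of_equiv (conjRepEquiv X e) hX, ?_⟩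
  funext g
  unfold ordinaryCharacter
  rw [Representation.char_iso (conjRepEquiv X e)]

section Irr

variable {G : Type*} [Group G] [Fintype G]

open Matrix in
-- Averaging gives a positive definite `G`-invariant matrix `H = ∑ N(h)ᴴ N(h)`, and `N(g⁻¹) = H⁻¹
-- N(g)ᴴ H` has the trace of `N(g)ᴴ`.
lemma character_inv {V : Type*} [AddCommGroup V] [Module AlgNum V] [FiniteDimensional AlgNum V]
    (X : Representation AlgNum G V) (g : G) :
    ((X.character g⁻¹ : AlgNum) : ℂ) = (starRingEnd ℂ) ((X.character g : AlgNum) : ℂ) := by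
  classical
  let b := Module.finBasis AlgNum V
  let N : G →* Matrix (Fin (Module.finrank AlgNum V)) (Fin (Module.finrank AlgNum V)) ℂ :=
    ((algebraMap AlgNum ℂ).mapMatrix.toMonoidHom.comp
      (LinearMap.toMatrixAlgEquiv b : Module.End AlgNum V →* _)).comp X
  have htr : ∀ g, ((X.character g : AlgNum) : ℂ) = (N g).trace := by
    intro g
    rw [Representation.character, LinearMap.trace_eq_matrix_trace AlgNum b]
    exact AddMonoidHom.map_trace (algebraMap AlgNum ℂ).toAddMonoidHom _
  let H := ∑ h, (N h)ᴴ * N h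
  have hpos : H.PosDef := by
    have h1 : H = 1 + ∑ h ∈ Finset.univ.erase (1 : G), (N h)ᴴ * N h := by
      simp only [H]
      rw [← Finset.add_sum_erase _ _ (Finset.mem_univ (1 : G)), map_one]
      simp
    rw [h1]
    exact PosDef.one.add_posSemidef
      (posSemidef_sum _ fun h _ => posSemidef_conjTranspose_mul_self (N h))
  have hcomm : H * N g⁻¹ = (N g)ᴴ * H := by
    simp only [H]
    rw [Finset.sum_mul, Finset.mul_sum, ← Equiv.sum_comp (Equiv.mulRight g)]
    refine Finset.sum_congr rfl fun h _ => ?_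
    rw [Equiv.coe_mulRight, mul_assoc, ← map_mul, mul_inv_cancel_right, map_mul,
      conjTranspose_mul, mul_assoc]
  have hdet : IsUnit H.det := (Matrix.isUnit_iff_isUnit_det H).1 hpos.isUnit
  rw [htr, htr, starRingEnd_apply, ← Matrix.trace_conjTranspose]
  calc (N g⁻¹).trace = (H⁻¹ * (H * N g⁻¹)).trace := by
        rw [← mul_assoc, Matrix.nonsing_inv_mul _ hdet, one_mul]
    _ = ((N g)ᴴ).trace := by
        rw [hcomm, Matrix.trace_mul_comm, mul_assoc, Matrix.mul_nonsing_inv _ hdet, mul_one]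

lemma ip_irr (χ ψ : Irr G) [Decidable (χ = ψ)] :
    ip (χ : G → ℂ) (ψ : G → ℂ) = if χ = ψ then 1 else 0 := by
  have hc : (Nat.card G : AlgNum) ≠ 0 := Nat.cast_ne_zero.2 Nat.card_pos.ne'
  have := invertibleOfNonzero hc
  have key : ∀ {n m : ℕ} (X : Representation AlgNum G (Fin n → AlgNum))
      (Y : Representation AlgNum G (Fin m → AlgNum)), ip (ordinaryCharacter X) (ordinaryCharacter Y)
        = (((Nat.card G : AlgNum)⁻¹ * ∑ g : G, X.character g * Y.character g⁻¹ : AlgNum) : ℂ) := by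
    intro n m X Y
    unfold ip ordinaryCharacter
    simp [character_inv]
  obtain ⟨n, X, hX, h⟩ := χ.2
  obtain ⟨m, Y, hY, h'⟩ := ψ.2
  split_ifs with hh
  · rw [← hh, h, key, Representation.char_orthonormal, if_pos ⟨.refl _⟩]
    rfl
  · rw [h, h', key, Representation.char_orthonormal, if_neg]
    · rfl
    · rintro ⟨e⟩
      refine hh (Subtype.ext ?_)
      rw [h, h']
      funext g
      rw [ordinaryCharacter, ordinaryCharacter, Representation.char_iso e]

lemma finite_Irr : Finite (Irr G) := by
  classical
  have : LinearIndependent ℂ (fun χ : Irr G => (χ : G → ℂ)) := by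
    rw [linearIndependent_iff']
    intro s c hc χ hχ
    have h := congrArg (fun f => ip f (χ : G → ℂ)) hc
    simp only [ip_sum_left, ip_smul_left, ip_irr] at h
    simpa [hχ, ip] using h
  exact this.finite

/-- The endomorphism `∑ f(g) X(g⁻¹)`. -/
def charOperator {V : Type*} [AddCommGroup V] [Module AlgNum V] (f : G → AlgNum)
    (X : Representation AlgNum G V) : Module.End AlgNum V := ∑ g, f g • X g⁻¹

/-- As `f` is a class function the operator commutes with `X`, so it is scalar by Schur; its trace
is 0 and the dimension is nonzero in `K`. -/
lemma charOperator_eq_zero_of_isIrreducible {V : Type*} [AddCommGroup V] [Module AlgNum V]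
    [FiniteDimensional AlgNum V] {f : G → AlgNum} (hf : ∀ g h, f (h * g * h⁻¹) = f g)
    {X : Representation AlgNum G V} (hX : X.IsIrreducible)
    (h0 : ∑ g, f g * X.character g⁻¹ = 0) : charOperator f X = 0 := by
  have hcomm : ∀ h, charOperator f X ∘ₗ X h = X h ∘ₗ charOperator f X := by
    intro h
    change charOperator f X * X h = X h * charOperator f X
    unfold charOperator
    rw [Finset.sum_mul, Finset.mul_sum, ← Equiv.sum_comp (MulAut.conj h).toEquiv]
    refine Finset.sum_congr rfl fun g _ => ?_
    change f (h * g * h⁻¹) • X (h * g * h⁻¹)⁻¹ * X h = _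
    rw [hf, smul_mul_assoc, mul_smul_comm, ← map_mul, ← map_mul]
    congr 2
    group
  let T : X.IntertwiningMap X := ⟨charOperator f X, hcomm⟩
  obtain ⟨c, hc⟩ :=
    (Representation.IsIrreducible.algebraMap_intertwiningMap_bijective_of_isAlgClosed (ρ := X)).2 T
  have hc' : charOperator f X = c • 1 := by
    have := congrArg Representation.IntertwiningMap.toLinearMap hc
    exact this.symm
  have htr : LinearMap.trace AlgNum V (charOperator f X) = 0 := by
    rw [← h0]
    unfold charOperator Representation.character
    simp
  rw [hc', map_smul, LinearMap.trace_one, smul_eq_mul, mul_eq_zero] at htr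
  have hnt : Nontrivial V := by
    have := IsSimpleModule.nontrivial (MonoidAlgebra AlgNum G) X.asModule
    exact X.asModuleEquiv.symm.toEquiv.nontrivial
  rw [hc', htr.resolve_right (Nat.cast_ne_zero.2 Module.finrank_pos.ne'), zero_smul]

/-- Maschke's theorem reduces this to the irreducible case by induction on the dimension. -/
lemma charOperator_eq_zero {V : Type*} [AddCommGroup V] [Module AlgNum V]
    [FiniteDimensional AlgNum V] {f : G → AlgNum} (hf : ∀ g h, f (h * g * h⁻¹) = f g)
    (h0 : ∀ χ : Irr G, ip (fun g => (f g : ℂ)) χ = 0) (X : Representation AlgNum G V) :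
    charOperator f X = 0 := by
  induction hd : Module.finrank AlgNum V using Nat.strong_induction_on generalizing V with
  | _ d ih =>
  rcases subsingleton_or_nontrivial V with hV | hV
  · exact Subsingleton.elim _ _
  by_cases hX : X.IsIrreducible
  · refine charOperator_eq_zero_of_isIrreducible hf hX ?_
    have h := h0 ⟨_, exists_ordinaryCharacter_mem_Irr hX⟩
    simp only [ip, ← character_inv] at h
    have hc : (Fintype.card G : ℂ)⁻¹ ≠ 0 := inv_ne_zero (Nat.cast_ne_zero.2 Fintype.card_ne_zero)
    apply Subtype.val_injective
    have h2 := (mul_eq_zero.1 h).resolve_left hc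
    refine Eq.trans ?_ h2
    exact (map_sum (algebraMap AlgNum ℂ) _ _).trans
      (Finset.sum_congr rfl fun g _ => map_mul (algebraMap AlgNum ℂ) _ _)
  · obtain ⟨U, hU1, hU2⟩ : ∃ U : Subrepresentation X, U ≠ ⊥ ∧ U ≠ ⊤ := by
      by_contra! h
      have : Nontrivial (Subrepresentation X) := by
        refine ⟨⊥, ⊤, fun hbt => ?_⟩
        have h2 := congrArg Subrepresentation.toSubmodule hbt
        exact bot_ne_top (α := Submodule AlgNum V) h2
      exact hX ⟨fun U => or_iff_not_imp_left.2 (h U)⟩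
    have hne : NeZero (Nat.card G : AlgNum) := ⟨Nat.cast_ne_zero.2 Nat.card_pos.ne'⟩
    have hss : Representation.IsSemisimpleRepresentation X := inferInstance
    obtain ⟨U', hU'⟩ := exists_isCompl U
    have hproper : ∀ W : Subrepresentation X, W ≠ ⊤ → ∀ w ∈ W.toSubmodule,
        charOperator f X w = 0 := by
      intro W hW w hw
      have hlt := Submodule.finrank_lt
        (s := W.toSubmodule) (fun h => hW (Subrepresentation.toSubmodule_injective h))
      have h := LinearMap.congr_fun (ih _ (hd ▸ hlt) W.toRepresentation rfl) ⟨w, hw⟩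
      have h2 := congrArg W.toSubmodule.subtype h
      simp only [charOperator, LinearMap.sum_apply, map_sum, LinearMap.smul_apply, map_smul] at h2 ⊢
      exact h2
    have hU'2 : U' ≠ ⊤ := by
      rintro rfl
      exact hU1 (by simpa using hU'.inf_eq_bot)
    refine LinearMap.ext fun v => ?_
    have hv : v ∈ U.toSubmodule ⊔ U'.toSubmodule := by
      rw [← Subrepresentation.toSubmodule_sup, hU'.sup_eq_top]
      trivial
    obtain ⟨u, hu, u', hu', rfl⟩ := Submodule.mem_sup.1 hv
    rw [map_add, hproper U hU2 u hu, hproper U' hU'2 u' hu', add_zero, LinearMap.zero_apply]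

/-- In the regular representation, applying the vanishing operator to the identity element reads off
all values of `f`. -/
lemma eq_zero_of_ip_irr_eq_zero {f : G → AlgNum} (hf : ∀ g h, f (h * g * h⁻¹) = f g)
    (h0 : ∀ χ : Irr G, ip (fun g => (f g : ℂ)) χ = 0) : f = 0 := by
  classical
  have h := LinearMap.congr_fun (charOperator_eq_zero hf h0 (Representation.leftRegular AlgNum G))
    (MonoidAlgebra.single 1 1)
  funext g
  have h1 := congrArg (fun x : MonoidAlgebra AlgNum G => x.coeff g⁻¹) h
  simp [charOperator, Finsupp.single_apply] at h1
  exact h1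

/-- Irreducible characters span the class functions. -/
theorem eq_sum_ip_irr [Fintype (Irr G)] {f : G → AlgNum} (hf : ∀ g h, f (h * g * h⁻¹) = f g) :
    (fun g => (f g : ℂ)) = ∑ χ : Irr G, ip (fun g => (f g : ℂ)) χ • (χ : G → ℂ) := by
  classical
  choose n X hX hχ using fun χ : Irr G => χ.2
  -- The inner products are formed inside `K`, so that the remainder `F` is `K`-valued and the
  -- vanishing criterion applies to it.
  let a : Irr G → AlgNum := fun χ => (Fintype.card G : AlgNum)⁻¹ * ∑ g, f g * (X χ).character g⁻¹
  have ha : ∀ χ, (a χ : ℂ) = ip (fun g => (f g : ℂ)) χ := by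
    intro χ
    rw [hχ χ]
    simp [a, ip, ordinaryCharacter, character_inv]
  let F : G → AlgNum := fun g => f g - ∑ χ, a χ * (X χ).character g
  have hF : (fun g => (F g : ℂ)) =
      (fun g => (f g : ℂ)) - ∑ χ : Irr G, ip (fun g => (f g : ℂ)) χ • (χ : G → ℂ) := by
    funext g
    simp only [Pi.sub_apply, Finset.sum_apply, Pi.smul_apply, smul_eq_mul, ← ha]
    simp only [F]
    rw [show ((f g - ∑ χ, a χ * (X χ).character g : AlgNum) : ℂ) =
      (f g : ℂ) - ∑ χ, (a χ : ℂ) * ((X χ).character g : ℂ) by simp]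
    congr 1
    refine Finset.sum_congr rfl fun χ _ => ?_
    conv_rhs => rw [hχ χ]
    rfl
  have hF0 : F = 0 := by
    refine eq_zero_of_ip_irr_eq_zero (fun g h => ?_) fun χ => ?_
    · simp [F, hf]
    · rw [hF, ip_sub_left, ip_sum_left]
      simp [ip_smul_left, ip_irr]
  rw [hF0] at hF
  refine (sub_eq_zero.1 (hF.symm.trans ?_))
  funext g
  rfl

end Irr

end ModChar

/-! ### Duality between PIMs and irreducible Brauer characters. -/

namespace ModChar

lemma mem_closure_range_iff {ι M : Type*} [Fintype ι] [AddCommMonoid M] {u : ι → M} {x : M} :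
    x ∈ AddSubmonoid.closure (Set.range u) ↔ ∃ c : ι → ℕ, x = ∑ i, c i • u i := by
  classical
  constructor
  · intro hx
    induction hx using AddSubmonoid.closure_induction with
    | mem x hx =>
      obtain ⟨i, rfl⟩ := hx
      exact ⟨Pi.single i 1, by simp [Pi.single_apply, ite_smul]⟩
    | zero => exact ⟨0, by simp⟩
    | add x y _ _ hx hy =>
      obtain ⟨c, rfl⟩ := hx
      obtain ⟨d, rfl⟩ := hy
      exact ⟨c + d, by simp [add_smul, Finset.sum_add_distrib]⟩
  · rintro ⟨c, rfl⟩
    exact sum_mem fun i _ => nsmul_mem (AddSubmonoid.subset_closure (Set.mem_range_self i)) (c i)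

section InnerProduct

variable {G : Type*} [Fintype G]

lemma ip_nsmul_left (n : ℕ) (a c : G → ℂ) : ip (n • a) c = n * ip a c := by
  rw [← Nat.cast_smul_eq_nsmul ℂ, ip_smul_left]

lemma ip_nsmul_right (n : ℕ) (a c : G → ℂ) : ip a (n • c) = n * ip a c := by
  rw [← Nat.cast_smul_eq_nsmul ℂ, ip_smul_right, Complex.conj_natCast]

lemma ip_zsmul_left (n : ℤ) (a c : G → ℂ) : ip (n • a) c = n * ip a c := by
  rw [← Int.cast_smul_eq_zsmul ℂ, ip_smul_left]

lemma ip_zsmul_right (n : ℤ) (a c : G → ℂ) : ip a (n • c) = n * ip a c := by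
  rw [← Int.cast_smul_eq_zsmul ℂ, ip_smul_right, map_intCast]

lemma ip_zero_left (c : G → ℂ) : ip 0 c = 0 := (ipForm G).map_zero₂ c

lemma ip_zero_right (c : G → ℂ) : ip c 0 = 0 := (ipForm G c).map_zero

end InnerProduct

variable {p : ℕ} {I : Ideal AlgInt} [I.IsMaximal] {G : Type*} [Group G] [Fintype G]

lemma brauerValue_conj {V : Type*} [AddCommGroup V] [Module (ResField I) V]
    [FiniteDimensional (ResField I) V] (X : Representation (ResField I) G V) (g h : G) :
    brauerValue p I X (h * g * h⁻¹) = brauerValue p I X g := by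
  have h1 : (X (h * g * h⁻¹)).charpoly = (X g).charpoly := by
    have hinv : (X h).comp (X h⁻¹) = LinearMap.id := by
      have := (map_mul X h h⁻¹).symm
      rwa [mul_inv_cancel, map_one] at this
    have hinv' : (X h⁻¹).comp (X h) = LinearMap.id := by
      have := (map_mul X h⁻¹ h).symm
      rwa [inv_mul_cancel, map_one] at this
    rw [← LinearEquiv.charpoly_conj (LinearEquiv.ofLinearMap (X h) (X h⁻¹) hinv hinv') (X g),
      map_mul, map_mul]
    rfl
  unfold brauerValue
  rw [h1]

lemma IsBrauerCharacter.mem_closure {θ : G → ℂ} (hθ : IsBrauerCharacter p I θ) :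
    θ ∈ AddSubmonoid.closure (IBr G p I) := by
  obtain ⟨n, X, rfl⟩ := hθ
  rw [brauerCharacter_eq_brauerFun]
  exact brauerFun_mem_closure_IBr X

lemma mem_closure_IBr_iff [Fintype (IBr G p I)] {θ : G → ℂ} :
    θ ∈ AddSubmonoid.closure (IBr G p I) ↔
      ∃ c : IBr G p I → ℕ, θ = ∑ φ, c φ • (φ : G → ℂ) := by
  rw [← mem_closure_range_iff, Subtype.range_coe]

lemma hat_mem_closure_IBr (hp : p.Prime) (hpI : (p : AlgInt) ∈ I) (χ : Irr G) :
    hat p (χ : G → ℂ) ∈ AddSubmonoid.closure (IBr G p I) := by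
  obtain ⟨n, X, hX, h⟩ := χ.2
  obtain ⟨m, Z, hZ⟩ := exists_reduction hp hpI X
  have : hat p (χ : G → ℂ) = brauerFun p I Z := by
    funext g
    unfold hat brauerFun
    split_ifs with hg
    · rfl
    · rw [h, hZ g hg]
      rfl
  rw [this]
  exact brauerFun_mem_closure_IBr Z

/-- A decomposition of `χ̂` exists by reduction modulo `I`, so `decompRow` does not take its default
value. -/
lemma hat_eq_sum_decompNumber [Fintype (IBr G p I)] (hp : p.Prime) (hpI : (p : AlgInt) ∈ I)
    (χ : Irr G) : hat p (χ : G → ℂ) =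
      ∑ φ : IBr G p I, decompNumber p I χ φ • (φ : G → ℂ) := by
  have h : ∃ d : IBr G p I →₀ ℕ,
      hat p (χ : G → ℂ) = d.sum (fun φ k => k • (φ : G → ℂ)) := by
    obtain ⟨c, hc⟩ := mem_closure_IBr_iff.1 (hat_mem_closure_IBr hp hpI χ)
    refine ⟨Finsupp.equivFunOnFinite.symm c, ?_⟩
    rw [hc, Finsupp.sum_fintype _ _ (by simp)]
    rfl
  unfold decompNumber decompRow
  rw [dif_pos h]
  exact h.choose_spec.trans (Finsupp.sum_fintype _ _ (by simp))

/-- Projective indecomposable characters are dual to irreducible Brauer characters. -/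
theorem ip_pim (hp : p.Prime) (hpI : (p : AlgInt) ∈ I) (φ ψ : IBr G p I) [Decidable (φ = ψ)] :
    ip (φ : G → ℂ) (pim p I ψ) = if φ = ψ then 1 else 0 := by
  classical
  have := finite_IBr (G := G) hp hpI
  have := finite_Irr (G := G)
  have := Fintype.ofFinite (IBr G p I)
  have := Fintype.ofFinite (Irr G)
  obtain ⟨n, X, -, hX⟩ := φ.2
  rw [brauerCharacter_eq_brauerFun] at hX
  let f : G → AlgNum := fun g => if p ∣ orderOf g then 0 else (brauerValue p I X g : AlgNum)
  have hf : (φ : G → ℂ) = fun g => (f g : ℂ) := by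
    rw [hX]
    funext g
    simp only [brauerFun, f]
    split_ifs <;> rfl
  have hconj : ∀ g h, f (h * g * h⁻¹) = f g := by
    intro g h
    have ho : orderOf (h * g * h⁻¹) = orderOf g :=
      orderOf_injective (MulAut.conj h).toMonoidHom (MulAut.conj h).injective g
    simp only [f, ho, brauerValue_conj]
  have hexp := eq_sum_ip_irr hconj
  rw [← hf] at hexp
  have hip : ∀ ω : IBr G p I, ip (φ : G → ℂ) (pim p I ω) =
      ∑ χ : Irr G, ip (φ : G → ℂ) χ * (decompNumber p I (χ : G → ℂ) ω : ℂ) := by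
    intro ω
    unfold pim
    rw [finsum_eq_sum_of_fintype, ip_sum_right]
    exact Finset.sum_congr rfl fun χ _ => by rw [ip_nsmul_right, mul_comm]
  -- Expand `φ` in `Irr`, replace each `χ` by `χ̂` since `φ` vanishes on `p`-singular elements, and
  -- decompose each `χ̂`.
  have hsum : (φ : G → ℂ) = ∑ ω : IBr G p I, ip (φ : G → ℂ) (pim p I ω) • (ω : G → ℂ) := by
    have h1 : (φ : G → ℂ) = ∑ χ : Irr G, ip (φ : G → ℂ) χ • hat p (χ : G → ℂ) := by
      funext g
      by_cases hg : p ∣ orderOf g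
      · simp [hat, hg, hf, f]
      · conv_lhs => rw [hexp]
        simp [hat, hg]
    conv_lhs => rw [h1]
    simp only [hip, Finset.sum_smul, hat_eq_sum_decompNumber hp hpI, Finset.smul_sum]
    rw [Finset.sum_comm]
    refine Finset.sum_congr rfl fun ω _ => Finset.sum_congr rfl fun χ _ => ?_
    rw [mul_smul, Nat.cast_smul_eq_nsmul]
  have hli := Fintype.linearIndependent_iff.1 (linearIndependent_IBr (G := G) hp hpI)
    (fun ω => ip (φ : G → ℂ) (pim p I ω) - if φ = ω then 1 else 0) (by
      simp only [sub_smul, Finset.sum_sub_distrib, ← hsum]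
      simp) ψ
  rw [sub_eq_zero.1 hli]
  congr

lemma IsProjectiveCharacter.exists_sum [Fintype (IBr G p I)] {Ψ : G → ℂ}
    (hΨ : IsProjectiveCharacter p I Ψ) : ∃ c : IBr G p I → ℕ, Ψ = ∑ φ, c φ • pim p I φ := by
  rw [← mem_closure_range_iff]
  refine AddSubmonoid.closure_mono ?_ hΨ
  rintro _ ⟨φ, rfl⟩
  exact ⟨φ, rfl⟩

lemma ip_sum_pim [Fintype (IBr G p I)] (hp : p.Prime) (hpI : (p : AlgInt) ∈ I)
    (c : IBr G p I → ℕ) (φ : IBr G p I) : ip (φ : G → ℂ) (∑ ψ, c ψ • pim p I ψ) = c φ := by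
  classical
  rw [ip_sum_right]
  simp only [ip_nsmul_right, ip_pim hp hpI]
  simp

lemma ip_sum_IBr [Fintype (IBr G p I)] (hp : p.Prime) (hpI : (p : AlgInt) ∈ I)
    (c : IBr G p I → ℕ) (φ : IBr G p I) : ip (∑ ψ, c ψ • (ψ : G → ℂ)) (pim p I φ) = c φ := by
  classical
  rw [ip_sum_left]
  simp only [ip_nsmul_left, ip_pim hp hpI]
  simp

lemma exists_ip_eq_natCast (hp : p.Prime) (hpI : (p : AlgInt) ∈ I) {θ Ψ : G → ℂ}
    (hθ : θ ∈ AddSubmonoid.closure (IBr G p I)) (hΨ : IsProjectiveCharacter p I Ψ) :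
    ∃ n : ℕ, ip θ Ψ = n := by
  have := finite_IBr (G := G) hp hpI
  have := Fintype.ofFinite (IBr G p I)
  obtain ⟨b, rfl⟩ := mem_closure_IBr_iff.1 hθ
  obtain ⟨c, rfl⟩ := hΨ.exists_sum
  refine ⟨∑ φ, b φ * c φ, ?_⟩
  rw [ip_sum_left]
  push_cast
  exact Finset.sum_congr rfl fun φ _ => by rw [ip_nsmul_left, ip_sum_pim hp hpI]

/-- `⟨θ,Φ_φ⟩` is the multiplicity of `φ` in `θ`, so one copy can be removed. -/
lemma sub_mem_closure_IBr (hp : p.Prime) (hpI : (p : AlgInt) ∈ I) {θ : G → ℂ}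
    (hθ : θ ∈ AddSubmonoid.closure (IBr G p I)) {φ : IBr G p I}
    (h : ip θ (pim p I φ) ≠ 0) : θ - φ ∈ AddSubmonoid.closure (IBr G p I) := by
  classical
  have := finite_IBr (G := G) hp hpI
  have := Fintype.ofFinite (IBr G p I)
  obtain ⟨b, rfl⟩ := mem_closure_IBr_iff.1 hθ
  rw [ip_sum_IBr hp hpI, Nat.cast_ne_zero] at h
  refine mem_closure_IBr_iff.2 ⟨b - Pi.single φ 1, sub_eq_iff_eq_add.2 ?_⟩
  have h1 : (φ : G → ℂ) = ∑ ψ : IBr G p I, (Pi.single φ 1 : IBr G p I → ℕ) ψ • (ψ : G → ℂ) := by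
    simp [Pi.single_apply, ite_smul]
  rw [h1, ← Finset.sum_add_distrib]
  refine Finset.sum_congr rfl fun ψ _ => ?_
  rw [← add_smul, Pi.sub_apply, Nat.sub_add_cancel]
  by_cases hψ : ψ = φ
  · subst hψ; simpa using Nat.one_le_iff_ne_zero.2 h
  · simp [Pi.single_eq_of_ne hψ]

lemma exists_constituent (hp : p.Prime) (hpI : (p : AlgInt) ∈ I) {θ Ψ : G → ℂ}
    (hθ : θ ∈ AddSubmonoid.closure (IBr G p I)) (h : ip θ Ψ ≠ 0) :
    ∃ φ : IBr G p I, ip θ (pim p I φ) ≠ 0 ∧ ip (φ : G → ℂ) Ψ ≠ 0 := by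
  have := finite_IBr (G := G) hp hpI
  have := Fintype.ofFinite (IBr G p I)
  obtain ⟨b, rfl⟩ := mem_closure_IBr_iff.1 hθ
  have h' := h
  rw [ip_sum_left] at h'
  obtain ⟨φ, -, hφ⟩ := Finset.exists_ne_zero_of_sum_ne_zero h'
  rw [ip_nsmul_left] at hφ
  exact ⟨φ, by rw [ip_sum_IBr hp hpI]; exact left_ne_zero_of_mul hφ, right_ne_zero_of_mul hφ⟩

lemma exists_ip_ne_zero (hp : p.Prime) (hpI : (p : AlgInt) ∈ I) {Ψ : G → ℂ}
    (hΨ : IsProjectiveCharacter p I Ψ) (h : Ψ ≠ 0) : ∃ φ : IBr G p I, ip (φ : G → ℂ) Ψ ≠ 0 := by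
  have := finite_IBr (G := G) hp hpI
  have := Fintype.ofFinite (IBr G p I)
  obtain ⟨c, rfl⟩ := hΨ.exists_sum
  by_contra! h0
  refine h (Finset.sum_eq_zero fun φ _ => ?_)
  have := h0 φ
  rw [ip_sum_pim hp hpI, Nat.cast_eq_zero] at this
  rw [this, zero_smul]

/-- Multiplicities of irreducible Brauer characters decide whether a difference of projective
characters is genuine. -/
lemma IsProjectiveCharacter.sub_nsmul (hp : p.Prime) (hpI : (p : AlgInt) ∈ I) {Ψ Φ : G → ℂ}
    (hΨ : IsProjectiveCharacter p I Ψ) (hΦ : IsProjectiveCharacter p I Φ) (z : ℕ)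
    (h : ∀ φ : IBr G p I, z * ip (φ : G → ℂ) Φ ≤ ip (φ : G → ℂ) Ψ) :
    IsProjectiveCharacter p I (Ψ - z • Φ) := by
  have := finite_IBr (G := G) hp hpI
  have := Fintype.ofFinite (IBr G p I)
  obtain ⟨c, rfl⟩ := hΨ.exists_sum
  obtain ⟨d, rfl⟩ := hΦ.exists_sum
  have hle : ∀ φ, z * d φ ≤ c φ := by
    intro φ
    have := h φ
    rw [ip_sum_pim hp hpI, ip_sum_pim hp hpI] at this
    exact_mod_cast this
  have : ∑ φ, c φ • pim p I φ - z • ∑ φ, d φ • pim p I φ =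
      ∑ φ : IBr G p I, (c φ - z * d φ) • pim p I φ := by
    rw [sub_eq_iff_eq_add, Finset.smul_sum, ← Finset.sum_add_distrib]
    refine Finset.sum_congr rfl fun φ _ => ?_
    rw [← mul_smul, ← add_smul, Nat.sub_add_cancel (hle φ)]
  rw [this]
  have hmem : ∀ φ : IBr G p I, IsProjectiveCharacter p I (pim p I φ) := fun φ =>
    AddSubmonoid.subset_closure ⟨φ, rfl⟩
  exact sum_mem fun φ _ => nsmul_mem (hmem φ) _

end ModChar

/-! ### Dual bases of the lattices `G₀` and `K₀`. -/

namespace ModChar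

section Dual

variable {G : Type*} [Fintype G] {ι : Type*} [Fintype ι] [DecidableEq ι] {u v : ι → G → ℂ} {s : ℕ}
  {b a : Fin s → G → ℂ}

/-- The integral base changes `N` (from `b` to `u`) and `M` (back) satisfy `N M = 1` as `b` is
independent; the columns of `M`, read in `v`, form the dual system. -/
lemma exists_dual_system (huv : ∀ i j, ip (u i) (v j) = if i = j then 1 else 0)
    (hb : LinearIndependent ℤ b)
    (hspan : Submodule.span ℤ (Set.range b) = Submodule.span ℤ (Set.range u)) :
    ∃ a : Fin s → G → ℂ, (∀ i, a i ∈ Submodule.span ℤ (Set.range v)) ∧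
      ∀ i j, ip (b i) (a j) = if i = j then 1 else 0 := by
  have hN : ∀ i, ∃ c : ι → ℤ, ∑ φ, c φ • u φ = b i := fun i =>
    (Submodule.mem_span_range_iff_exists_fun ℤ).1 (hspan ▸ Submodule.subset_span ⟨i, rfl⟩)
  have hM : ∀ φ, ∃ c : Fin s → ℤ, ∑ i, c i • b i = u φ := fun φ =>
    (Submodule.mem_span_range_iff_exists_fun ℤ).1 (hspan ▸ Submodule.subset_span ⟨φ, rfl⟩)
  choose N hN using hN
  choose M hM using hM
  have hNM : ∀ i j, ∑ φ, N i φ * M φ j = if i = j then 1 else 0 := by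
    intro i j
    have h := Fintype.linearIndependent_iff.1 hb
      (fun j => ∑ φ, N i φ * M φ j - if i = j then 1 else 0) ?_ j
    · exact sub_eq_zero.1 h
    · simp only [sub_smul, Finset.sum_sub_distrib, Finset.sum_smul, mul_smul]
      rw [Finset.sum_comm]
      simp only [← Finset.smul_sum, hM, hN]
      simp
  refine ⟨fun j => ∑ φ, M φ j • v φ, fun j => Submodule.sum_mem _ fun φ _ =>
    Submodule.smul_mem _ _ (Submodule.subset_span ⟨φ, rfl⟩), fun i j => ?_⟩
  rw [← hN i, ip_sum_left]
  simp only [ip_zsmul_left, ip_sum_right, ip_zsmul_right, huv]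
  have := congrArg (Int.cast : ℤ → ℂ) (hNM i j)
  push_cast at this
  simpa [mul_comm] using this

/-- `b` and `u` span the same lattice, and pairing with `u i` returns the `i`-th coefficient of `x`
in `v`. -/
lemma eq_zero_of_ip_eq_zero (huv : ∀ i j, ip (u i) (v j) = if i = j then 1 else 0)
    (hspan : Submodule.span ℤ (Set.range b) = Submodule.span ℤ (Set.range u)) {x : G → ℂ}
    (hx : x ∈ Submodule.span ℤ (Set.range v)) (h : ∀ i, ip (b i) x = 0) : x = 0 := by
  have hu : ∀ y ∈ Submodule.span ℤ (Set.range b), ip y x = 0 := by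
    intro y hy
    obtain ⟨c, rfl⟩ := (Submodule.mem_span_range_iff_exists_fun ℤ).1 hy
    rw [ip_sum_left]
    exact Finset.sum_eq_zero fun i _ => by rw [ip_zsmul_left, h, mul_zero]
  obtain ⟨c, rfl⟩ := (Submodule.mem_span_range_iff_exists_fun ℤ).1 hx
  refine Finset.sum_eq_zero fun i _ => ?_
  have h1 := hu (u i) (hspan ▸ Submodule.subset_span ⟨i, rfl⟩)
  rw [ip_sum_right] at h1
  simp only [ip_zsmul_right, huv] at h1
  have : c i = 0 := by simpa using h1
  rw [this, zero_smul]

lemma eq_sum_dual_system (huv : ∀ i j, ip (u i) (v j) = if i = j then 1 else 0)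
    (hspan : Submodule.span ℤ (Set.range b) = Submodule.span ℤ (Set.range u))
    (ha : ∀ i, a i ∈ Submodule.span ℤ (Set.range v))
    (hba : ∀ i j, ip (b i) (a j) = if i = j then 1 else 0) {x : G → ℂ}
    (hx : x ∈ Submodule.span ℤ (Set.range v)) {n : Fin s → ℕ} (hn : ∀ i, ip (b i) x = n i) :
    x = ∑ i, n i • a i := by
  rw [← sub_eq_zero]
  refine eq_zero_of_ip_eq_zero huv hspan
    (sub_mem hx (sum_mem fun i _ => nsmul_mem (ha i) _)) fun i => ?_
  rw [ip_sub_right, ip_sum_right, hn]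
  simp only [ip_nsmul_right, hba]
  simp

end Dual

section Lattices

variable {p : ℕ} {I : Ideal AlgInt} [I.IsMaximal] {G : Type*} [Group G] [Fintype G]
  (B : Set (Block G p I)) {s : ℕ} {BS PS : Fin s → G → ℂ}

lemma G0_eq_span_range :
    G0 B = Submodule.span ℤ (Set.range fun φ : {φ // InBlocks B φ} => (φ.1 : G → ℂ)) := by
  unfold G0
  congr 1
  ext θ
  constructor
  · rintro ⟨φ, h, rfl⟩
    exact ⟨⟨φ, h⟩, rfl⟩
  · rintro ⟨⟨φ, h⟩, rfl⟩
    exact ⟨φ, h, rfl⟩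

lemma K0_eq_span_range :
    K0 B = Submodule.span ℤ (Set.range fun φ : {φ // InBlocks B φ} => pim p I φ.1) := by
  unfold K0
  congr 1
  ext θ
  constructor
  · rintro ⟨φ, h, rfl⟩
    exact ⟨⟨φ, h⟩, rfl⟩
  · rintro ⟨⟨φ, h⟩, rfl⟩
    exact ⟨φ, h, rfl⟩

variable {B}

lemma projAtoms_spec (hp : p.Prime) (hpI : (p : AlgInt) ∈ I) (hBS : IsBasicBrauer B BS) :
    (∀ i, projAtoms B BS i ∈ K0 B) ∧
      ∀ i j, ip (BS i) (projAtoms B BS j) = if i = j then 1 else 0 := by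
  classical
  have := finite_IBr (G := G) hp hpI
  have := Fintype.ofFinite {φ : IBr G p I // InBlocks B φ}
  have h : ∃ a : Fin s → G → ℂ, (∀ i, a i ∈ K0 B) ∧
      ∀ i j, ip (BS i) (a j) = if i = j then 1 else 0 := by
    rw [K0_eq_span_range]
    refine exists_dual_system (fun φ ψ => ?_) hBS.linearIndependent
      (hBS.span_eq.trans (G0_eq_span_range B))
    simp only [ip_pim hp hpI, Subtype.ext_iff]
  unfold projAtoms dualSystem
  rw [dif_pos h]
  exact h.choose_spec

lemma ip_pim_IBr (hp : p.Prime) (hpI : (p : AlgInt) ∈ I) (φ ψ : IBr G p I) [Decidable (φ = ψ)] :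
    ip (pim p I φ) (ψ : G → ℂ) = if φ = ψ then 1 else 0 := by
  classical
  rw [← conj_ip, ip_pim hp hpI]
  simp only [eq_comm (a := ψ)]
  split_ifs <;> simp

lemma brauerAtoms_spec (hp : p.Prime) (hpI : (p : AlgInt) ∈ I) (hPS : IsBasicProjective B PS) :
    (∀ i, brauerAtoms B PS i ∈ G0 B) ∧
      ∀ i j, ip (PS i) (brauerAtoms B PS j) = if i = j then 1 else 0 := by
  classical
  have := finite_IBr (G := G) hp hpI
  have := Fintype.ofFinite {φ : IBr G p I // InBlocks B φ}
  have h : ∃ a : Fin s → G → ℂ, (∀ i, a i ∈ G0 B) ∧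
      ∀ i j, ip (PS i) (a j) = if i = j then 1 else 0 := by
    rw [G0_eq_span_range]
    refine exists_dual_system (fun φ ψ => ?_) hPS.linearIndependent
      (hPS.span_eq.trans (K0_eq_span_range B))
    simp only [ip_pim_IBr hp hpI, Subtype.ext_iff]
  unfold brauerAtoms dualSystem
  rw [dif_pos h]
  exact h.choose_spec

lemma eq_sum_brauerAtoms (hp : p.Prime) (hpI : (p : AlgInt) ∈ I) (hPS : IsBasicProjective B PS)
    {x : G → ℂ} (hx : x ∈ G0 B) {n : Fin s → ℕ} (hn : ∀ i, ip x (PS i) = n i) :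
    x = ∑ i, n i • brauerAtoms B PS i := by
  classical
  have := finite_IBr (G := G) hp hpI
  have := Fintype.ofFinite {φ : IBr G p I // InBlocks B φ}
  obtain ⟨h1, h2⟩ := brauerAtoms_spec hp hpI hPS
  rw [G0_eq_span_range] at hx h1
  refine eq_sum_dual_system (fun φ ψ => ?_) (hPS.span_eq.trans (K0_eq_span_range B)) h1 h2 hx
    fun i => ?_
  · simp only [ip_pim_IBr hp hpI, Subtype.ext_iff]
  · rw [← conj_ip, hn, Complex.conj_natCast]

lemma exists_ip_eq_intCast (hp : p.Prime) (hpI : (p : AlgInt) ∈ I) {x Ψ : G → ℂ} (hx : x ∈ G0 B)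
    (hΨ : IsProjectiveCharacter p I Ψ) : ∃ n : ℤ, ip x Ψ = n := by
  unfold G0 at hx
  induction hx using Submodule.span_induction with
  | mem x hx =>
    obtain ⟨φ, -, rfl⟩ := hx
    obtain ⟨n, hn⟩ := exists_ip_eq_natCast hp hpI (AddSubmonoid.subset_closure φ.2) hΨ
    exact ⟨n, by rw [hn]; simp⟩
  | zero => exact ⟨0, by rw [ip_zero_left]; simp⟩
  | add x y _ _ hx hy =>
    obtain ⟨m, hm⟩ := hx
    obtain ⟨n, hn⟩ := hy
    exact ⟨m + n, by rw [ip_add_left, hm, hn]; simp⟩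
  | smul c x _ hx =>
    obtain ⟨m, hm⟩ := hx
    exact ⟨c * m, by rw [ip_zsmul_left, hm]; simp⟩

/-- By duality `φ` pairs to 0 with every PIM but its own. Hence constituents detected by elements of
`K₀` lie in `G₀` and can be written in Brauer atoms. -/
lemma inBlocks_of_ip_ne_zero (hp : p.Prime) (hpI : (p : AlgInt) ∈ I) {φ : IBr G p I} {Φ : G → ℂ}
    (hΦ : Φ ∈ K0 B) (h : ip (φ : G → ℂ) Φ ≠ 0) : InBlocks B φ := by
  classical
  by_contra hB
  apply h
  clear h
  unfold K0 at hΦ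
  induction hΦ using Submodule.span_induction with
  | mem x hx =>
    obtain ⟨ψ, hψ, rfl⟩ := hx
    rw [ip_pim hp hpI, if_neg]
    rintro rfl
    exact hB hψ
  | zero => exact ip_zero_right _
  | add x y _ _ hx hy => rw [ip_add_right, hx, hy, add_zero]
  | smul c x _ hx => rw [ip_zsmul_right, hx, mul_zero]

lemma exists_basic_ip_ne_zero (hBS : IsBasicBrauer B BS) {x Ψ : G → ℂ} (hx : x ∈ G0 B)
    (h : ip x Ψ ≠ 0) : ∃ i, ip (BS i) Ψ ≠ 0 := by
  rw [← hBS.span_eq] at hx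
  obtain ⟨c, rfl⟩ := (Submodule.mem_span_range_iff_exists_fun ℤ).1 hx
  rw [ip_sum_left] at h
  obtain ⟨i, -, hi⟩ := Finset.exists_ne_zero_of_sum_ne_zero h
  rw [ip_zsmul_left] at hi
  exact ⟨i, right_ne_zero_of_mul hi⟩

end Lattices

/-- `ℂ` is only partially ordered, so the minimum is found in `ℕ`. -/
lemma exists_isLeast_natCast {V : Set ℂ} (hV : ∀ c ∈ V, ∃ n : ℕ, c = n) (hne : V.Nonempty) :
    ∃ m : ℕ, IsLeast V m := by
  have hne' : {n : ℕ | (n : ℂ) ∈ V}.Nonempty := by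
    obtain ⟨c, hc⟩ := hne
    obtain ⟨n, rfl⟩ := hV c hc
    exact ⟨n, hc⟩
  refine ⟨sInf {n : ℕ | (n : ℂ) ∈ V}, Nat.sInf_mem hne', fun c hc => ?_⟩
  obtain ⟨n, rfl⟩ := hV c hc
  exact Nat.cast_le.2 (Nat.sInf_le hc)

end ModChar

/-! ### Irreducible constituents as bits, and the two cases of the theorem. -/

namespace ModChar

lemma le_maxMult {G : Type*} [Fintype G] {s : ℕ} {PS : Fin s → G → ℂ}
    {J : Set (Fin s)} {T : Set (G → ℂ)} {i j : Fin s}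
    (hi : i ∈ J) (hj : j ∉ J) {n : ℕ} (h : ∀ θ ∈ T, 0 ≤ ip θ (PS j - n • PS i)) : (n : ℕ∞) ≤ maxMult PS J T i j := by
  unfold maxMult
  rw [if_neg (not_not.2 hi), if_neg hj]
  exact le_iSup₂ (f := fun (n : ℕ) (_ : n ∈ {n : ℕ | ∀ φ ∈ T, 0 ≤ ip φ (PS j - n • PS i)}) =>
    (n : ℕ∞)) n h

section Bits

variable {p : ℕ} {I : Ideal AlgInt} [I.IsMaximal] {G : Type*} [Group G] [Fintype G]
  {B : Set (Block G p I)} {s : ℕ} {BS PS : Fin s → G → ℂ}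

/-- The irreducible constituents of a basic Brauer character satisfy the conditions common to
both kinds of bits. -/
lemma exists_constituent_coefficients (hp : p.Prime) (hpI : (p : AlgInt) ∈ I)
    (hBS : IsBasicBrauer B BS) (hPS : IsBasicProjective B PS) {φ : IBr G p I}
    (hφ : (φ : G → ℂ) ∈ G0 B) {i : Fin s} (h : ip (BS i) (pim p I φ) ≠ 0) :
    ∃ n n' : Fin s → ℕ, BS i = ∑ j, n j • brauerAtoms B PS j ∧
      (φ : G → ℂ) = ∑ j, n' j • brauerAtoms B PS j ∧ (∀ j, n' j ≤ n j) ∧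
      (∀ j, ip (φ : G → ℂ) (PS j) = n' j) ∧
      ∀ Ψ, IsProjectiveCharacter p I Ψ → 0 ≤ ip (φ : G → ℂ) Ψ ∧ 0 ≤ ip (BS i - (φ : G → ℂ)) Ψ := by
  have hi := (hBS.genuine i).mem_closure
  have hφc : (φ : G → ℂ) ∈ AddSubmonoid.closure (IBr G p I) := AddSubmonoid.subset_closure φ.2
  have hsub := sub_mem_closure_IBr hp hpI hi h
  have hpos : ∀ Ψ, IsProjectiveCharacter p I Ψ →
      0 ≤ ip (φ : G → ℂ) Ψ ∧ 0 ≤ ip (BS i - (φ : G → ℂ)) Ψ := by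
    intro Ψ hΨ
    obtain ⟨a, ha⟩ := exists_ip_eq_natCast hp hpI hφc hΨ
    obtain ⟨b, hb⟩ := exists_ip_eq_natCast hp hpI hsub hΨ
    rw [ha, hb]
    exact ⟨Nat.cast_nonneg a, Nat.cast_nonneg b⟩
  choose n hn using fun j => exists_ip_eq_natCast hp hpI hi (hPS.genuine j)
  choose n' hn' using fun j => exists_ip_eq_natCast hp hpI hφc (hPS.genuine j)
  have hiG : BS i ∈ G0 B := hBS.span_eq ▸ Submodule.subset_span ⟨i, rfl⟩
  refine ⟨n, n', eq_sum_brauerAtoms hp hpI hPS hiG hn, eq_sum_brauerAtoms hp hpI hPS hφ hn',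
    fun j => ?_, hn', hpos⟩
  have := (hpos _ (hPS.genuine j)).2
  rw [ip_sub_left, hn, hn', sub_nonneg] at this
  exact_mod_cast this

/-- A bit need not be a Brauer character, so its pairing with a projective character is a priori
only an integer; non-negativity is assumed separately. -/
lemma exists_ip_eq_natCast_of_nonneg (hp : p.Prime) (hpI : (p : AlgInt) ∈ I)
    (hPS : IsBasicProjective B PS) {S : G → ℂ} (hS : IsProjectiveCharacter p I S)
    (n : Fin s → ℕ) (h : 0 ≤ ip (∑ j, n j • brauerAtoms B PS j) S) :
    ∃ c : ℕ, ip (∑ j, n j • brauerAtoms B PS j) S = c := by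
  have hmem : (∑ j, n j • brauerAtoms B PS j) ∈ G0 B :=
    sum_mem fun j _ => nsmul_mem ((brauerAtoms_spec hp hpI hPS).1 j) _
  obtain ⟨c, hc⟩ := exists_ip_eq_intCast hp hpI hmem hS
  rw [hc] at h ⊢
  lift c to ℕ using by exact_mod_cast h
  exact ⟨c, by simp⟩

lemma ip_basic_pos (hp : p.Prime) (hpI : (p : AlgInt) ∈ I)
    (hBS : IsBasicBrauer B BS) {Ψ : G → ℂ} (hΨ : IsProjectiveCharacter p I Ψ) {i : Fin s}
    (h : ip (BS i) Ψ ≠ 0) : 0 < ip (BS i) Ψ := by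
  obtain ⟨n, hn⟩ := exists_ip_eq_natCast hp hpI (hBS.genuine i).mem_closure hΨ
  rw [hn] at h ⊢
  exact Nat.cast_pos.2 (Nat.pos_of_ne_zero (Nat.cast_ne_zero.1 h))

variable {T P : Set (G → ℂ)} {J : Set (Fin s)} {k : Fin s}

lemma isPimBit_constituent (hp : p.Prime) (hpI : (p : AlgInt) ∈ I)
    (hBS : IsBasicBrauer B BS) (hPS : IsBasicProjective B PS)
    (hT : ∀ θ ∈ T, θ ∈ AddSubmonoid.closure (IBr G p I))
    (hP : ∀ Ψ ∈ P, IsProjectiveCharacter p I Ψ) (hJ : ∀ j ∈ J, IsPIM p I (PS j)) (hk : k ∈ J)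
    {φ : IBr G p I} (hφk : PS k = pim p I φ) (hφ : (φ : G → ℂ) ∈ G0 B) {i : Fin s}
    (h : ip (BS i) (PS k) ≠ 0) : IsPimBit B PS P T J k (BS i) φ := by
  classical
  obtain ⟨n, n', h1, h2, h3, h4, h5⟩ :=
    exists_constituent_coefficients hp hpI hBS hPS hφ (hφk ▸ h)
  refine ⟨n, n', h1, h2, h3, ?_, fun j hj hjk => ?_, fun j hj => le_maxMult hk hj fun θ hθ => ?_,
    fun Ψ hΨ => h5 Ψ (hP Ψ hΨ)⟩
  · have := h4 k
    rw [hφk, ip_pim hp hpI, if_pos rfl] at this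
    exact_mod_cast this.symm
  · obtain ⟨ψ, hψ⟩ := hJ j hj
    have := h4 j
    rw [hψ, ip_pim hp hpI, if_neg] at this
    · exact_mod_cast this.symm
    · rintro rfl
      -- Different indices give different members of a basis, hence different PIMs.
      exact hjk (hPS.linearIndependent.injective (hψ.trans hφk.symm))
  -- `n' j` is the exact multiplicity of the PIM `PS k` in `PS j`, so the difference is genuine and
  -- passes every test in `T`.
  · have hproj : IsProjectiveCharacter p I (PS j - n' j • PS k) := by
      refine (hPS.genuine j).sub_nsmul hp hpI (hPS.genuine k) _ fun ω => ?_
      rw [hφk, ip_pim hp hpI]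
      split_ifs with hω
      · rw [hω, h4, mul_one]
      · rw [mul_zero]
        obtain ⟨c, hc⟩ := exists_ip_eq_natCast hp hpI (AddSubmonoid.subset_closure ω.2)
          (hPS.genuine j)
        rw [hc]
        exact Nat.cast_nonneg c
    obtain ⟨c, hc⟩ := exists_ip_eq_natCast hp hpI (hT θ hθ) hproj
    rw [hc]
    exact Nat.cast_nonneg c

lemma isMultFreeBit_constituent (hp : p.Prime) (hpI : (p : AlgInt) ∈ I)
    (hBS : IsBasicBrauer B BS) (hPS : IsBasicProjective B PS)
    (hT : ∀ θ ∈ T, θ ∈ AddSubmonoid.closure (IBr G p I))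
    (hP : ∀ Ψ ∈ P, IsProjectiveCharacter p I Ψ) (hJ : ∀ j ∈ J, IsPIM p I (PS j))
    {φ : IBr G p I} (hφ1 : ip (φ : G → ℂ) (PS k) = 1) (hφ : (φ : G → ℂ) ∈ G0 B) {i : Fin s}
    (h : ip (BS i) (pim p I φ) ≠ 0) : IsMultFreeBit B PS P T J k (BS i) φ := by
  classical
  obtain ⟨n, n', h1, h2, h3, h4, h5⟩ := exists_constituent_coefficients hp hpI hBS hPS hφ h
  refine ⟨n, n', h1, h2, h3, ?_, fun j hj => ?_, fun Ψ hΨ => h5 Ψ (hP Ψ hΨ)⟩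
  · have := h4 k
    rw [hφ1] at this
    exact_mod_cast this.symm
  · obtain ⟨ψ, hψ⟩ := hJ j hj
    have hj4 := h4 j
    rw [hψ, ip_pim hp hpI] at hj4
    split_ifs at hj4 with hφψ
    swap
    · have : n' j = 0 := by exact_mod_cast hj4.symm
      rw [this]
      exact zero_le
    have hn1 : n' j = 1 := by exact_mod_cast hj4.symm
    subst hφψ
    rw [hn1]
    -- If `k ∈ J`, then `PS k` and `PS j` are both the PIM of `φ`, so `j = k` and the bound is 1.
    -- Otherwise `PS j` is a summand of `PS k`, since `⟨φ, PS k⟩ = 1`.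
    by_cases hk : k ∈ J
    · obtain ⟨ω, hω⟩ := hJ k hk
      rw [hω, ip_pim hp hpI] at hφ1
      have hφω : φ = ω := by
        by_contra hne
        rw [if_neg hne] at hφ1
        exact zero_ne_one hφ1
      have hjk : j = k := hPS.linearIndependent.injective (by rw [hψ, hω, hφω])
      unfold maxMult
      rw [if_neg (not_not.2 hj), if_pos hk, if_pos hjk]
      exact le_rfl
    · refine le_maxMult hj hk fun θ hθ => ?_
      have hproj : IsProjectiveCharacter p I (PS k - 1 • PS j) := by
        refine (hPS.genuine k).sub_nsmul hp hpI (hPS.genuine j) _ fun ω => ?_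
        rw [hψ, ip_pim hp hpI]
        split_ifs with hω
        · rw [hω, hφ1]; simp
        · rw [mul_zero]
          obtain ⟨c, hc⟩ := exists_ip_eq_natCast hp hpI (AddSubmonoid.subset_closure ω.2)
            (hPS.genuine k)
          rw [hc]
          exact Nat.cast_nonneg c
      obtain ⟨c, hc⟩ := exists_ip_eq_natCast hp hpI (hT θ hθ) hproj
      rw [hc]
      exact Nat.cast_nonneg c

/-- The values of the minima, given a supply of bits. -/
lemma exists_minima (hp : p.Prime) (hpI : (p : AlgInt) ∈ I) (hPS : IsBasicProjective B PS)
    {S : G → ℂ} (hS : IsProjectiveCharacter p I S) (Bit : (G → ℂ) → (G → ℂ) → Prop)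
    (hBit : ∀ φ φ', Bit φ φ' →
      (∃ n : Fin s → ℕ, φ' = ∑ j, n j • brauerAtoms B PS j) ∧ 0 ≤ ip φ' S)
    (hex : ∀ i, 0 < ip (BS i) (PS k) → ∃ φ', Bit (BS i) φ') :
    ∃ m : Fin s → ℕ, ∀ i, 0 < ip (BS i) (PS k) →
      IsLeast {c : ℂ | ∃ φ' : G → ℂ, Bit (BS i) φ' ∧ c = ip φ' S} (m i : ℂ) := by
  have h : ∀ i, ∃ m : ℕ, 0 < ip (BS i) (PS k) →
      IsLeast {c : ℂ | ∃ φ' : G → ℂ, Bit (BS i) φ' ∧ c = ip φ' S} (m : ℂ) := by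
    intro i
    by_cases hi : 0 < ip (BS i) (PS k)
    · have hnat : ∀ c ∈ {c : ℂ | ∃ φ' : G → ℂ, Bit (BS i) φ' ∧ c = ip φ' S}, ∃ n : ℕ, c = n := by
        rintro _ ⟨φ', hb, rfl⟩
        obtain ⟨⟨n, rfl⟩, h0⟩ := hBit _ _ hb
        exact exists_ip_eq_natCast_of_nonneg hp hpI hPS hS n h0
      obtain ⟨φ', hb⟩ := hex i hi
      obtain ⟨m, hm⟩ := exists_isLeast_natCast hnat ⟨_, φ', hb, rfl⟩
      exact ⟨m, fun _ => hm⟩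
    -- A dummy value for basic characters that do not pair positively with `PS k`.
    · exact ⟨0, fun h => absurd h hi⟩
  choose m hm using h
  exact ⟨m, hm⟩

lemma IsBasicProjective.mem_K0 (hPS : IsBasicProjective B PS) (k : Fin s) : PS k ∈ K0 B :=
  hPS.span_eq ▸ Submodule.subset_span ⟨k, rfl⟩

lemma mem_G0_of_ip_ne_zero (hp : p.Prime) (hpI : (p : AlgInt) ∈ I) {φ : IBr G p I} {Φ : G → ℂ}
    (hΦ : Φ ∈ K0 B) (h : ip (φ : G → ℂ) Φ ≠ 0) : (φ : G → ℂ) ∈ G0 B :=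
  Submodule.subset_span ⟨φ, inBlocks_of_ip_ne_zero hp hpI hΦ h, rfl⟩

/-- The coefficients of `PS k` in the projective atoms are its pairings with `BS`. As `φ` is a
constituent of some `BS i`, `⟨φ, PS k⟩ ≤ ⟨BS i, PS k⟩ ≤ 1`. -/
lemma MultiplicityFree.ip_eq_one (hp : p.Prime) (hpI : (p : AlgInt) ∈ I)
    (hBS : IsBasicBrauer B BS) (hPS : IsBasicProjective B PS)
    (hm : MultiplicityFree B BS (PS k)) {φ : IBr G p I} (h : ip (φ : G → ℂ) (PS k) ≠ 0) :
    ip (φ : G → ℂ) (PS k) = 1 := by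
  classical
  obtain ⟨n, hn, hn01⟩ := hm
  have hφ := mem_G0_of_ip_ne_zero hp hpI (hPS.mem_K0 k) h
  obtain ⟨i, hi⟩ := exists_basic_ip_ne_zero hBS hφ (Ψ := pim p I φ)
    (by rw [ip_pim hp hpI, if_pos rfl]; exact one_ne_zero)
  have hni : ip (BS i) (PS k) = n i := by
    rw [hn, ip_sum_right]
    simp only [ip_nsmul_right, (projAtoms_spec hp hpI hBS).2]
    simp
  obtain ⟨a, ha⟩ := exists_ip_eq_natCast hp hpI
    (sub_mem_closure_IBr hp hpI (hBS.genuine i).mem_closure hi) (hPS.genuine k)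
  obtain ⟨b, hb⟩ := exists_ip_eq_natCast hp hpI (AddSubmonoid.subset_closure φ.2) (hPS.genuine k)
  rw [ip_sub_left, hni, hb, sub_eq_iff_eq_add] at ha
  have hab : n i = a + b := by exact_mod_cast ha
  rw [hb, Nat.cast_ne_zero] at h
  have hb1 : b = 1 := by
    rcases hn01 i with h0 | h0 <;> omega
  rw [hb, hb1, Nat.cast_one]

lemma exists_ip_basic_pos (hp : p.Prime) (hpI : (p : AlgInt) ∈ I) (hBS : IsBasicBrauer B BS)
    (hPS : IsBasicProjective B PS) (k : Fin s) : ∃ i, 0 < ip (BS i) (PS k) := by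
  obtain ⟨φ₀, hφ₀⟩ := exists_ip_ne_zero hp hpI (hPS.genuine k) (hPS.linearIndependent.ne_zero k)
  obtain ⟨i₀, hi₀⟩ := exists_basic_ip_ne_zero hBS
    (mem_G0_of_ip_ne_zero hp hpI (hPS.mem_K0 k) hφ₀) hφ₀
  exact ⟨i₀, ip_basic_pos hp hpI hBS (hPS.genuine k) hi₀⟩

theorem exists_sub_nsmul_of_isPIM (hp : p.Prime) (hpI : (p : AlgInt) ∈ I)
    (hBS : IsBasicBrauer B BS) (hPS : IsBasicProjective B PS)
    (hT : ∀ θ ∈ T, θ ∈ AddSubmonoid.closure (IBr G p I))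
    (hP : ∀ Ψ ∈ P, IsProjectiveCharacter p I Ψ) (hJ : ∀ j ∈ J, IsPIM p I (PS j))
    {S : G → ℂ} (hS : S ∈ P) (hk : k ∈ J) :
    ∃ (m : Fin s → ℕ) (z : ℕ),
      (∀ i, 0 < ip (BS i) (PS k) →
        IsLeast {c : ℂ | ∃ φ' : G → ℂ, IsPimBit B PS P T J k (BS i) φ' ∧ c = ip φ' S}
          (m i : ℂ)) ∧
      IsGreatest {a : ℕ | ∃ i, 0 < ip (BS i) (PS k) ∧ a = m i} z ∧
      IsProjectiveCharacter p I (S - z • PS k) := by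
  classical
  have hSp := hP S hS
  obtain ⟨i₀, hi₀pos⟩ := exists_ip_basic_pos hp hpI hBS hPS k
  obtain ⟨φ, hφk⟩ := hJ k hk
  have hφ : (φ : G → ℂ) ∈ G0 B := by
    refine mem_G0_of_ip_ne_zero hp hpI (hPS.mem_K0 k) ?_
    rw [hφk, ip_pim hp hpI, if_pos rfl]
    exact one_ne_zero
  have hbit : ∀ i, 0 < ip (BS i) (PS k) →
      IsPimBit B PS P T J k (BS i) φ := fun i hi =>
    isPimBit_constituent hp hpI hBS hPS hT hP hJ hk hφk hφ hi.ne'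
  obtain ⟨m, hm⟩ := exists_minima (BS := BS) (k := k) hp hpI hPS hSp
    (IsPimBit B PS P T J k)
    (fun _ _ ⟨_, n', _, h2, _, _, _, _, h⟩ => ⟨⟨n', h2⟩, (h S hS).1⟩)
    (fun i hi => ⟨φ, hbit i hi⟩)
  obtain ⟨i₁, hi₁, hmax⟩ := Finset.exists_max_image
    (Finset.univ.filter fun i => 0 < ip (BS i) (PS k)) m ⟨i₀, by simpa using hi₀pos⟩
  have hi₁pos : 0 < ip (BS i₁) (PS k) := by simpa using hi₁
  refine ⟨m, m i₁, hm, ⟨⟨i₁, hi₁pos, rfl⟩, ?_⟩, ?_⟩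
  · rintro _ ⟨i, hi, rfl⟩
    exact hmax i (by simpa using hi)
  · refine hSp.sub_nsmul hp hpI (hPS.genuine k) _ fun ω => ?_
    rw [hφk, ip_pim hp hpI]
    split_ifs with hω
    · rw [hω, mul_one]
      -- The same `φ` is a bit at every admissible index, in particular where the minimum is
      -- largest.
      exact (hm i₁ hi₁pos).2 ⟨φ, hbit i₁ hi₁pos, rfl⟩
    · rw [mul_zero]
      obtain ⟨c, hc⟩ := exists_ip_eq_natCast hp hpI (AddSubmonoid.subset_closure ω.2) hSp
      rw [hc]
      exact Nat.cast_nonneg c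

theorem exists_sub_nsmul_of_multiplicityFree (hp : p.Prime) (hpI : (p : AlgInt) ∈ I)
    (hBS : IsBasicBrauer B BS) (hPS : IsBasicProjective B PS)
    (hT : ∀ θ ∈ T, θ ∈ AddSubmonoid.closure (IBr G p I))
    (hP : ∀ Ψ ∈ P, IsProjectiveCharacter p I Ψ) (hJ : ∀ j ∈ J, IsPIM p I (PS j))
    {S : G → ℂ} (hS : S ∈ P) 
    (hmf : MultiplicityFree B BS (PS k)) :
    ∃ (m : Fin s → ℕ) (z : ℕ),
      (∀ i, 0 < ip (BS i) (PS k) →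
        IsLeast {c : ℂ | ∃ φ' : G → ℂ, IsMultFreeBit B PS P T J k (BS i) φ' ∧ c = ip φ' S}
          (m i : ℂ)) ∧
      IsLeast {a : ℕ | ∃ i, 0 < ip (BS i) (PS k) ∧ a = m i} z ∧
      IsProjectiveCharacter p I (S - z • PS k) := by
  classical
  have hSp := hP S hS
  obtain ⟨i₀, hi₀pos⟩ := exists_ip_basic_pos hp hpI hBS hPS k
  have hbit : ∀ (φ : IBr G p I) (i : Fin s), ip (φ : G → ℂ) (PS k) ≠ 0 →
      ip (BS i) (pim p I φ) ≠ 0 →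
      IsMultFreeBit B PS P T J k (BS i) φ := fun φ i h1 h2 =>
    isMultFreeBit_constituent hp hpI hBS hPS hT hP hJ (hmf.ip_eq_one hp hpI hBS hPS h1)
      (mem_G0_of_ip_ne_zero hp hpI (hPS.mem_K0 k) h1) h2
  obtain ⟨m, hm⟩ := exists_minima (BS := BS) (k := k) hp hpI hPS hSp
    (IsMultFreeBit B PS P T J k)
    (fun _ _ ⟨_, n', _, h2, _, _, _, h⟩ => ⟨⟨n', h2⟩, (h S hS).1⟩)
    (fun i hi => by
      obtain ⟨φ, h1, h2⟩ := exists_constituent hp hpI (hBS.genuine i).mem_closure hi.ne'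
      exact ⟨φ, hbit φ i h2 h1⟩)
  obtain ⟨i₁, hi₁, hmin⟩ := Finset.exists_min_image
    (Finset.univ.filter fun i => 0 < ip (BS i) (PS k)) m ⟨i₀, by simpa using hi₀pos⟩
  have hi₁pos : 0 < ip (BS i₁) (PS k) := by simpa using hi₁
  refine ⟨m, m i₁, hm, ⟨⟨i₁, hi₁pos, rfl⟩, ?_⟩, ?_⟩
  · rintro _ ⟨i, hi, rfl⟩
    exact hmin i (by simpa using hi)
  · refine hSp.sub_nsmul hp hpI (hPS.genuine k) _ fun ω => ?_
    by_cases hω : ip (ω : G → ℂ) (PS k) = 0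
    · rw [hω, mul_zero]
      obtain ⟨c, hc⟩ := exists_ip_eq_natCast hp hpI (AddSubmonoid.subset_closure ω.2) hSp
      rw [hc]
      exact Nat.cast_nonneg c
    · rw [hmf.ip_eq_one hp hpI hBS hPS hω, mul_one]
      obtain ⟨i, hi⟩ := exists_basic_ip_ne_zero hBS
        (mem_G0_of_ip_ne_zero hp hpI (hPS.mem_K0 k) hω) (Ψ := pim p I ω)
        (by rw [ip_pim hp hpI, if_pos rfl]; exact one_ne_zero)
      have hb := hbit ω i hω hi
      -- `BS i` contains `ω`; if it paired to 0 with `PS k`, removing `ω` would leave a Brauer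
      -- character pairing to `-1`.
      have hik : 0 < ip (BS i) (PS k) := by
        refine ip_basic_pos hp hpI hBS (hPS.genuine k) fun h0 => ?_
        obtain ⟨a, ha⟩ := exists_ip_eq_natCast hp hpI
          (sub_mem_closure_IBr hp hpI (hBS.genuine i).mem_closure hi) (hPS.genuine k)
        rw [ip_sub_left, h0, hmf.ip_eq_one hp hpI hBS hPS hω, sub_eq_iff_eq_add] at ha
        have : 0 = a + 1 := by exact_mod_cast ha
        omega
      refine le_trans (Nat.cast_le.2 (hmin i (by simpa using hik))) ?_
      exact (hm i hik).2 ⟨ω, hb, rfl⟩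

end Bits

end ModChar

end

theorem mainTheorem9 {G : Type*} [Group G] [Fintype G] {p : ℕ} (hp : p.Prime)
    {I : Ideal ModChar.AlgInt} [I.IsMaximal] (hpI : (p : ModChar.AlgInt) ∈ I)
    (B : Set (ModChar.Block G p I)) {s : ℕ} (BS PS : Fin s → G → ℂ)
    (hBS : ModChar.IsBasicBrauer B BS) (hPS : ModChar.IsBasicProjective B PS)
    (Bt P : Set (G → ℂ)) (hBt : ∀ φ ∈ Bt, ModChar.IsBrauerCharacter p I φ)
    (hP : ∀ Ψ ∈ P, ModChar.IsProjectiveCharacter p I Ψ)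
    (J : Set (Fin s)) (hJ : ∀ j ∈ J, ModChar.IsPIM p I (PS j))
    (k : Fin s) (S : G → ℂ) (hS : S ∈ P) :
    (k ∈ J →
      ∃ (m : Fin s → ℕ) (z : ℕ),
        (∀ i, 0 < ModChar.ip (BS i) (PS k) →
          IsLeast {c : ℂ | ∃ φ' : G → ℂ,
            ModChar.IsPimBit B PS P (Bt ∪ Set.range BS) J k (BS i) φ' ∧
            c = ModChar.ip φ' S} (m i : ℂ)) ∧
        IsGreatest {a : ℕ | ∃ i, 0 < ModChar.ip (BS i) (PS k) ∧ a = m i} z ∧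
        ModChar.IsProjectiveCharacter p I (S - z • PS k)) ∧
    (ModChar.MultiplicityFree B BS (PS k) →
      ∃ (m : Fin s → ℕ) (z : ℕ),
        (∀ i, 0 < ModChar.ip (BS i) (PS k) →
          IsLeast {c : ℂ | ∃ φ' : G → ℂ,
            ModChar.IsMultFreeBit B PS P (Bt ∪ Set.range BS) J k (BS i) φ' ∧
            c = ModChar.ip φ' S} (m i : ℂ)) ∧
        IsLeast {a : ℕ | ∃ i, 0 < ModChar.ip (BS i) (PS k) ∧ a = m i} z ∧
        ModChar.IsProjectiveCharacter p I (S - z • PS k)) := by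
  -- All that is used of the test characters is that they are sums of irreducible Brauer characters.
  have hT : ∀ θ ∈ Bt ∪ Set.range BS, θ ∈ AddSubmonoid.closure (ModChar.IBr G p I) := by
    rintro θ (hθ | ⟨i, rfl⟩)
    · exact (hBt θ hθ).mem_closure
    · exact (hBS.genuine i).mem_closure
  exact ⟨ModChar.exists_sub_nsmul_of_isPIM hp hpI hBS hPS hT hP hJ hS,
    ModChar.exists_sub_nsmul_of_multiplicityFree hp hpI hBS hPS hT hP hJ hS⟩
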